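/- Let $n\ge 4$, $G=SO(n)$, $H=SO(2)\times SO(n-3)$, embedded in $G$ as the block matrices $\mathrm{diag}(1,R,C)$, and let $M=G/H$. Let $B=\mathrm{diag}\bigl(1,\begin{pmatrix}0&1\\-1&0\end{pmatrix},-1,\dots,-1\bigr)$. The automorphism $\Phi(A)=BAB^{-1}$ of $G$ makes $M$ a $4$-symmetric space. Let $\varphi(X)=BXB^{-1}$ on $\mathfrak{so}(n)$, $\mathfrak m=(\varphi-\mathrm{id})\mathfrak{so}(n)$ (identified with the tangent space of $M$ at $o=H$) and $\theta=\varphi|_{\mathfrak m}$. An invariant affinor structure on $M$ (an $Ad(H)$-invariant endomorphism of $\mathfrak m$) is canonical if it is a polynomial in $\theta$, and it is an $f$-structure if $f^3+f=0$. Let $\mathfrak m=\mathfrak m_1\oplus\mathfrak m_2\oplus\mathfrak m_3$, where $\mathfrak m_1,\mathfrak m_2,\mathfrak m_3$ consist of the skew-symmetric matrices whose non-zero entries lie only in the blocks between the index sets $\{1\}$ and $\{2,3\}$, $\{2,3\}$ and $\{4,\dots,n\}$, $\{1\}$ and $\{4,\dots,n\}$ respectively. Let $g_0$ be minus the Killing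 form of $\mathfrak{so}(n)$, restricted to $\mathfrak m$. An invariant Riemannian metric $g$ on $M$ has characteristic numbers $(s,t)$, $s,t>0$, if, up to a positive constant factor, $g=g_0|_{\mathfrak m_1}+s\,g_0|_{\mathfrak m_2}+t\,g_0|_{\mathfrak m_3}$ (with $\mathfrak m_1,\mathfrak m_2,\mathfrak m_3$ mutually orthogonal). An $f$-structure $f$ on a Riemannian manifold $(M,g)$ with Levi-Civita connection $\nabla$ is metric if $\langle fX,Y\rangle+\langle X,fY\rangle=0$ for all vector fields $X,Y$. A metric $f$-structure is a Killing $f$-structure if $\nabla_X(f)X=0$ for all $X$, a nearly Kähler $f$-structure ($NKf$-structure) if $\nabla_{fX}(f)fX=0$ for all $X$, and a $G_1f$-structure if $T(X,X)=0$ for all $X$, where $T(X,Y)=\frac14 f\bigl(\nabla_{fX}(f)fY-\nabla_{f^2X}(f)f^2Y\bigr)$. Theorem 2. The structures $f_0=\frac12(\theta-\theta^3)$ and $-f_0$ are exactly the non-zero canonical $f$-structures on the $4$-symmetric space $M$; thus $f_0$ is the only one up to sign. For every invariant Riemannian metric $g$ on $M$: 1) $f_0$ is a Killing $f$-structure with respect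 to $g$ if and only if $g$ has characteristic numbers $(1,\frac43)$; 2) $f_0$ is a nearly Kähler $f$-structure with respect to $g$ if and only if $g$ has characteristic numbers $(1,t)$ for some $t>0$; 3) $f_0$ is a $G_1f$-structure with respect to $g$ if $n\ge5$, or if $n=4$ and $g$ has characteristic numbers. -/

import Mathlib

open scoped Matrix ContDiff

noncomputable section

namespace FlagSpace

/-! ### The group, the isotropy subgroup and the automorphism -/

/-- The `n` indices (for `n ≥ 4`), grouped as `{1}`, `{2, 3}`, `{4, …, n}`. -/
abbrev Ix (n : ℕ) : Type := Fin 1 ⊕ (Fin 2 ⊕ Fin (n - 3))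

/-- Real square matrices of order `n`. -/
abbrev Mat (n : ℕ) : Type := Matrix (Ix n) (Ix n) ℝ

/-- The Lie group `SO(n)`. -/
abbrev G (n : ℕ) : Type := Matrix.specialOrthogonalGroup (Ix n) ℝ

/-- The block-diagonal matrix `diag(1, R, C)`. -/
def blockDiag (n : ℕ) (R : Matrix (Fin 2) (Fin 2) ℝ)
    (C : Matrix (Fin (n - 3)) (Fin (n - 3)) ℝ) : Mat n :=
  Matrix.fromBlocks 1 0 0 (Matrix.fromBlocks R 0 0 C)

lemma blockDiag_mul (n : ℕ) (R R' : Matrix (Fin 2) (Fin 2) ℝ)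
    (C C' : Matrix (Fin (n - 3)) (Fin (n - 3)) ℝ) :
    blockDiag n R C * blockDiag n R' C' = blockDiag n (R * R') (C * C') := by
  simp [blockDiag, Matrix.fromBlocks_multiply]

lemma blockDiag_one (n : ℕ) : blockDiag n 1 1 = 1 := by
  simp [blockDiag]

lemma blockDiag_transpose (n : ℕ) (R : Matrix (Fin 2) (Fin 2) ℝ)
    (C : Matrix (Fin (n - 3)) (Fin (n - 3)) ℝ) :
    (blockDiag n R C)ᵀ = blockDiag n Rᵀ Cᵀ := by
  simp [blockDiag, Matrix.fromBlocks_transpose]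

lemma coe_inv (n : ℕ) (g : G n) : ((g⁻¹ : G n) : Mat n) = (g : Mat n)ᵀ := by
  ext i j; rfl

lemma coe_mul_transpose (n : ℕ) (g : G n) : (g : Mat n) * (g : Mat n)ᵀ = 1 :=
  (Matrix.mem_orthogonalGroup_iff _ _).1 (Matrix.mem_specialOrthogonalGroup_iff.1 g.2).1

lemma coe_transpose_mul (n : ℕ) (g : G n) : (g : Mat n)ᵀ * (g : Mat n) = 1 :=
  (Matrix.mem_orthogonalGroup_iff' _ _).1 (Matrix.mem_specialOrthogonalGroup_iff.1 g.2).1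

/-- The subgroup `SO(2) × SO(n-3)` of `SO(n)`: the matrices `diag(1, R, C)` with
`R ∈ SO(2)` and `C ∈ SO(n-3)`. -/
def H (n : ℕ) : Subgroup (G n) where
  carrier := {g | ∃ R ∈ Matrix.specialOrthogonalGroup (Fin 2) ℝ,
    ∃ C ∈ Matrix.specialOrthogonalGroup (Fin (n - 3)) ℝ, (g : Mat n) = blockDiag n R C}
  one_mem' := ⟨1, one_mem _, 1, one_mem _, by rw [blockDiag_one]; rfl⟩
  mul_mem' := by
    rintro a b ⟨R, hR, C, hC, h⟩ ⟨R', hR', C', hC', h'⟩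
    refine ⟨R * R', mul_mem hR hR', C * C', mul_mem hC hC', ?_⟩
    rw [← blockDiag_mul, ← h, ← h']; rfl
  inv_mem' := by
    rintro a ⟨R, hR, C, hC, h⟩
    refine ⟨Rᵀ, ((⟨R, hR⟩ : Matrix.specialOrthogonalGroup (Fin 2) ℝ)⁻¹).2,
      Cᵀ, ((⟨C, hC⟩ : Matrix.specialOrthogonalGroup (Fin (n - 3)) ℝ)⁻¹).2, ?_⟩
    rw [coe_inv, h, blockDiag_transpose]

/-- The homogeneous space `M = SO(n) / (SO(2) × SO(n-3))`. -/
abbrev M (n : ℕ) : Type := G n ⧸ H n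

/-- The matrix `B = diag(1, (0 1; -1 0), -1, …, -1)`. -/
def B (n : ℕ) : Mat n := blockDiag n !![0, 1; -1, 0] (-1)

lemma B_mul_transpose (n : ℕ) : B n * (B n)ᵀ = 1 := by
  rw [B, blockDiag_transpose, blockDiag_mul, ← blockDiag_one]
  congr 1
  · ext i j; fin_cases i <;> fin_cases j <;> simp [Matrix.mul_apply, Fin.sum_univ_two]
  · simp

lemma B_inv (n : ℕ) : (B n)⁻¹ = (B n)ᵀ := Matrix.inv_eq_right_inv (B_mul_transpose n)

lemma B_transpose_mul (n : ℕ) : (B n)ᵀ * B n = 1 :=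
  mul_eq_one_comm.1 (B_mul_transpose n)

/-- The linear map `X ↦ B X B⁻¹`; on `so(n)` it is the differential `φ` at the identity of the
inner automorphism `Φ : A ↦ B A B⁻¹` of `SO(n)`. -/
def phi (n : ℕ) : Mat n →ₗ[ℝ] Mat n :=
  LinearMap.mulLeft ℝ (B n) ∘ₗ LinearMap.mulRight ℝ (B n)⁻¹

lemma phi_apply (n : ℕ) (X : Mat n) : phi n X = B n * (X * (B n)ᵀ) := by
  simp [phi, B_inv]

/-- The automorphism `Φ : A ↦ B A B⁻¹` of `SO(n)`. -/
def Phi (n : ℕ) : G n →* G n where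
  toFun g := ⟨B n * g * (B n)⁻¹, by
    rw [Matrix.mem_specialOrthogonalGroup_iff, Matrix.mem_orthogonalGroup_iff, B_inv]
    have hg := coe_mul_transpose n g
    have hB := B_transpose_mul n
    constructor
    · calc B n * (g : Mat n) * (B n)ᵀ * (B n * (g : Mat n) * (B n)ᵀ)ᵀ
          = B n * (g : Mat n) * ((B n)ᵀ * B n) * (g : Mat n)ᵀ * (B n)ᵀ := by
            simp [Matrix.transpose_mul, Matrix.mul_assoc]
        _ = B n * ((g : Mat n) * (g : Mat n)ᵀ) * (B n)ᵀ := by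
            rw [hB]; simp [Matrix.mul_assoc]
        _ = 1 := by rw [hg, Matrix.mul_one, B_mul_transpose]
    · have h1 : (B n).det * (B n)ᵀ.det = 1 := by
        rw [← Matrix.det_mul, B_mul_transpose, Matrix.det_one]
      have h2 : (g : Mat n).det = 1 := (Matrix.mem_specialOrthogonalGroup_iff.1 g.2).2
      rw [Matrix.det_mul, Matrix.det_mul, h2, mul_one, h1]⟩
  map_one' := Subtype.ext (by
    change B n * 1 * (B n)⁻¹ = 1
    rw [B_inv, Matrix.mul_one, B_mul_transpose])
  map_mul' a b := Subtype.ext (by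
    change B n * ((a : Mat n) * (b : Mat n)) * (B n)⁻¹
      = B n * (a : Mat n) * (B n)⁻¹ * (B n * (b : Mat n) * (B n)⁻¹)
    rw [B_inv]
    calc _ = B n * (a : Mat n) * 1 * (b : Mat n) * (B n)ᵀ := by simp [Matrix.mul_assoc]
      _ = _ := by rw [← B_transpose_mul]; simp [Matrix.mul_assoc])

/-- Elements of `H` commute with `B`, that is, `H` consists of fixed points of `Φ`. -/
lemma H_comm_B (n : ℕ) (h : H n) : (h : Mat n) * B n = B n * (h : Mat n) := by
  obtain ⟨⟨g, hg⟩, R, hR, C, hC, e⟩ := h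
  change g = _ at e
  subst e
  change blockDiag n R C * B n = B n * blockDiag n R C
  rw [B, blockDiag_mul, blockDiag_mul]
  obtain ⟨h1, h2, -⟩ := Matrix.mem_specialOrthogonalGroup_fin_two_iff.1 hR
  congr 1
  · ext i j
    fin_cases i <;> fin_cases j <;> simp [Matrix.mul_apply, Fin.sum_univ_two, h1, h2]
  · simp

/-- `G/H` is a homogeneous `Φ`-space of order `k` (a `k`-symmetric space): `Φ^k = id` and
`(G^Φ)₀ ⊆ H ⊆ G^Φ`, where `G^Φ` is the group of fixed points of `Φ` and `(G^Φ)₀` its identity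
component. -/
def IsPhiSpaceOfOrder {Γ : Type*} [Group Γ] [TopologicalSpace Γ] (Φ : Γ →* Γ) (K : Subgroup Γ)
    (k : ℕ) : Prop :=
  (∀ a, Φ^[k] a = a) ∧ connectedComponentIn {a | Φ a = a} 1 ⊆ (K : Set Γ) ∧
    (K : Set Γ) ⊆ {a | Φ a = a}

lemma Phi_eq_iff (n : ℕ) (g : G n) : Phi n g = g ↔ (g : Mat n) * B n = B n * (g : Mat n) := by
  rw [Subtype.ext_iff]
  change B n * (g : Mat n) * (B n)⁻¹ = (g : Mat n) ↔ _
  rw [B_inv]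
  constructor
  · intro h
    calc (g : Mat n) * B n = B n * (g : Mat n) * (B n)ᵀ * B n := by rw [h]
      _ = _ := by rw [Matrix.mul_assoc, B_transpose_mul, Matrix.mul_one]
  · intro h
    rw [← h, Matrix.mul_assoc, B_mul_transpose, Matrix.mul_one]

/-- A fixed point of `Φ` with upper left entry `1` lies in `H`. -/
lemma mem_H_of_comm (n : ℕ) (g : G n) (h : (g : Mat n) * B n = B n * (g : Mat n))
    (h1 : (g : Mat n) (Sum.inl 0) (Sum.inl 0) = 1) : g ∈ H n := by
  obtain ⟨g, hg⟩ := g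
  change g * B n = B n * g at h
  change g (Sum.inl 0) (Sum.inl 0) = 1 at h1
  obtain ⟨ho, hdet⟩ := Matrix.mem_specialOrthogonalGroup_iff.1 hg
  have ho := (Matrix.mem_orthogonalGroup_iff _ _).1 ho
  have ent := fun i j => congrFun (congrFun h i) j
  have e12 : ∀ i j, g (Sum.inl i) (Sum.inr (Sum.inl j)) = 0 := by
    intro i j
    fin_cases i
    have a := ent (Sum.inl 0) (Sum.inr (Sum.inl 0))
    have b := ent (Sum.inl 0) (Sum.inr (Sum.inl 1))
    simp [B, blockDiag, Matrix.mul_apply, Fin.sum_univ_two] at a b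
    fin_cases j <;> simp <;> linarith
  have e13 : ∀ i j, g (Sum.inl i) (Sum.inr (Sum.inr j)) = 0 := by
    intro i j
    fin_cases i
    have a := ent (Sum.inl 0) (Sum.inr (Sum.inr j))
    simp [B, blockDiag, Matrix.mul_apply, Matrix.one_apply] at a
    simp; linarith
  have e21 : ∀ i j, g (Sum.inr (Sum.inl j)) (Sum.inl i) = 0 := by
    intro i j
    fin_cases i
    have a := ent (Sum.inr (Sum.inl 0)) (Sum.inl 0)
    have b := ent (Sum.inr (Sum.inl 1)) (Sum.inl 0)
    simp [B, blockDiag, Matrix.mul_apply, Fin.sum_univ_two] at a b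
    fin_cases j <;> simp <;> linarith
  have e31 : ∀ i j, g (Sum.inr (Sum.inr j)) (Sum.inl i) = 0 := by
    intro i j
    fin_cases i
    have a := ent (Sum.inr (Sum.inr j)) (Sum.inl 0)
    simp [B, blockDiag, Matrix.mul_apply, Matrix.one_apply] at a
    simp; linarith
  have e23 : ∀ i j, g (Sum.inr (Sum.inl i)) (Sum.inr (Sum.inr j)) = 0 := by
    intro i j
    have a := ent (Sum.inr (Sum.inl 0)) (Sum.inr (Sum.inr j))
    have b := ent (Sum.inr (Sum.inl 1)) (Sum.inr (Sum.inr j))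
    simp [B, blockDiag, Matrix.mul_apply, Fin.sum_univ_two, Matrix.one_apply] at a b
    fin_cases i <;> simp <;> linarith
  have e32 : ∀ i j, g (Sum.inr (Sum.inr j)) (Sum.inr (Sum.inl i)) = 0 := by
    intro i j
    have a := ent (Sum.inr (Sum.inr j)) (Sum.inr (Sum.inl 0))
    have b := ent (Sum.inr (Sum.inr j)) (Sum.inr (Sum.inl 1))
    simp [B, blockDiag, Matrix.mul_apply, Fin.sum_univ_two, Matrix.one_apply] at a b
    fin_cases i <;> simp <;> linarith
  set R : Matrix (Fin 2) (Fin 2) ℝ :=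
    Matrix.of fun i j => g (Sum.inr (Sum.inl i)) (Sum.inr (Sum.inl j)) with hR
  set C : Matrix (Fin (n - 3)) (Fin (n - 3)) ℝ :=
    Matrix.of fun i j => g (Sum.inr (Sum.inr i)) (Sum.inr (Sum.inr j)) with hC
  have hgB : g = blockDiag n R C := by
    ext i j
    rcases i with i | i | i <;> rcases j with j | j | j
    · fin_cases i; fin_cases j; simpa [blockDiag] using h1
    all_goals simp [blockDiag, e12, e13, e21, e31, e23, e32, hR, hC]
  have hRR : blockDiag n (R * Rᵀ) (C * Cᵀ) = blockDiag n 1 1 := by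
    rw [← blockDiag_mul, ← blockDiag_transpose, ← hgB, ho, blockDiag_one]
  have hRR' := (Matrix.fromBlocks_inj.1 (Matrix.fromBlocks_inj.1 hRR).2.2.2)
  have c1 := ent (Sum.inr (Sum.inl 0)) (Sum.inr (Sum.inl 0))
  have c2 := ent (Sum.inr (Sum.inl 0)) (Sum.inr (Sum.inl 1))
  rw [hgB] at c1 c2
  simp [B, blockDiag, Matrix.mul_apply, Fin.sum_univ_two] at c1 c2
  have c3 := congrFun (congrFun hRR'.1 0) 0
  simp [Matrix.mul_apply, Fin.sum_univ_two] at c3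
  have hRm : R ∈ Matrix.specialOrthogonalGroup (Fin 2) ℝ :=
    Matrix.mem_specialOrthogonalGroup_fin_two_iff.2 ⟨by linarith, by linarith, by linarith⟩
  refine ⟨R, hRm, C, ?_, hgB⟩
  refine Matrix.mem_specialOrthogonalGroup_iff.2
    ⟨(Matrix.mem_orthogonalGroup_iff _ _).2 hRR'.2.2.2, ?_⟩
  have hd := (Matrix.mem_specialOrthogonalGroup_iff.1 hRm).2
  rw [hgB, blockDiag, Matrix.det_fromBlocks_zero₂₁, Matrix.det_fromBlocks_zero₂₁, hd] at hdet
  simpa using hdet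

/-- `SO(n) / (SO(2) × SO(n-3))` is a `4`-symmetric space. -/
theorem isPhiSpaceOfOrder_four (n : ℕ) : IsPhiSpaceOfOrder (Phi n) (H n) 4 := by
  refine ⟨fun a => ?_, ?_, fun a ha => (Phi_eq_iff n a).2 (H_comm_B n ⟨a, ha⟩)⟩
  · have hB2 : B n * B n = blockDiag n (-1) 1 := by
      rw [B, blockDiag_mul]
      congr 1
      · ext i j; fin_cases i <;> fin_cases j <;> simp [Matrix.mul_apply, Fin.sum_univ_two]
      · simp
    have hB4 : B n * (B n * (B n * B n)) = 1 := by
      rw [← Matrix.mul_assoc, hB2, blockDiag_mul, ← blockDiag_one]; simp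
    have hT4 : (B n)ᵀ * ((B n)ᵀ * ((B n)ᵀ * (B n)ᵀ)) = 1 := by
      have := congrArg Matrix.transpose hB4
      simpa [Matrix.transpose_mul, Matrix.mul_assoc] using this
    apply Subtype.ext
    change B n * (B n * (B n * (B n * (a : Mat n) * (B n)⁻¹) * (B n)⁻¹) * (B n)⁻¹) * (B n)⁻¹
      = (a : Mat n)
    rw [B_inv]
    calc _ = (B n * (B n * (B n * B n))) * (a : Mat n)
          * ((B n)ᵀ * ((B n)ᵀ * ((B n)ᵀ * (B n)ᵀ))) := by simp only [Matrix.mul_assoc]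
      _ = _ := by rw [hB4, hT4, Matrix.one_mul, Matrix.mul_one]
  · intro g hg
    have hsub := connectedComponentIn_subset {a : G n | Phi n a = a} 1
    have hpre := isPreconnected_connectedComponentIn (x := (1 : G n)) (F := {a | Phi n a = a})
    have h1 : (1 : G n) ∈ connectedComponentIn {a : G n | Phi n a = a} 1 :=
      mem_connectedComponentIn (map_one (Phi n))
    have hcont : Continuous fun a : G n => (a : Mat n) (Sum.inl 0) (Sum.inl 0) :=
      continuous_subtype_val.matrix_elem _ _
    have hsq : ∀ a : G n, Phi n a = a →
        (a : Mat n) (Sum.inl 0) (Sum.inl 0) * (a : Mat n) (Sum.inl 0) (Sum.inl 0) = 1 := by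
      intro a ha
      have ent := fun j => congrFun (congrFun ((Phi_eq_iff n a).1 ha) (Sum.inl 0)) j
      have ho := congrFun (congrFun (coe_mul_transpose n a) (Sum.inl 0)) (Sum.inl 0)
      have a0 := ent (Sum.inr (Sum.inl 0))
      have a1 := ent (Sum.inr (Sum.inl 1))
      have a2 := fun j => ent (Sum.inr (Sum.inr j))
      simp [B, blockDiag, Matrix.mul_apply, Fin.sum_univ_two, Matrix.one_apply] at a0 a1 a2
      have b0 : (a : Mat n) (Sum.inl 0) (Sum.inr (Sum.inl 0)) = 0 := by linarith
      have b1 : (a : Mat n) (Sum.inl 0) (Sum.inr (Sum.inl 1)) = 0 := by linarith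
      have b2 : ∀ j, (a : Mat n) (Sum.inl 0) (Sum.inr (Sum.inr j)) = 0 := fun j => by
        have := a2 j; linarith
      simpa [Matrix.mul_apply, Fin.sum_univ_two, b0, b1, b2] using ho
    refine mem_H_of_comm n g ((Phi_eq_iff n g).1 (hsub hg)) ?_
    rcases mul_self_eq_one_iff.1 (hsq g (hsub hg)) with h | h
    · exact h
    · exfalso
      have himg := (hpre.image _ hcont.continuousOn).ordConnected.out
        ⟨g, hg, h⟩ ⟨1, h1, Matrix.one_apply_eq _⟩
      obtain ⟨a, ha, ha0⟩ := himg (show (0 : ℝ) ∈ Set.Icc (-1) 1 by constructor <;> norm_num)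
      have := hsq a (hsub ha)
      dsimp only at ha0
      rw [ha0] at this
      norm_num at this

/-! ### The canonical reductive complement -/

/-- The Lie algebra `so(n)` of skew-symmetric matrices. -/
def so (n : ℕ) : Submodule ℝ (Mat n) where
  carrier := {X | Xᵀ = -X}
  zero_mem' := by simp
  add_mem' := by
    intro X Y hX hY
    simp only [Set.mem_ofPred_eq] at hX hY ⊢
    rw [Matrix.transpose_add, hX, hY, neg_add]
  smul_mem' := by
    intro c X hX
    simp only [Set.mem_ofPred_eq] at hX ⊢
    rw [Matrix.transpose_smul, hX, smul_neg]

/-- The canonical reductive complement `𝔪 = (φ - id) so(n)`. -/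
def m (n : ℕ) : Submodule ℝ (Mat n) :=
  (so n).map (phi n - LinearMap.id)

lemma phi_mem_so (n : ℕ) {X : Mat n} (hX : X ∈ so n) :
    phi n X ∈ so n := by
  change Xᵀ = -X at hX
  change (_)ᵀ = -_
  simp [phi_apply, Matrix.transpose_mul, hX, Matrix.mul_assoc]

lemma m_le_so (n : ℕ) {X : Mat n} (hX : X ∈ m n) :
    X ∈ so n := by
  obtain ⟨Y, hY, rfl⟩ := hX
  exact (so n).sub_mem (phi_mem_so n hY) hY

lemma phi_mem_m (n : ℕ) {X : Mat n} (hX : X ∈ m n) : phi n X ∈ m n := by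
  obtain ⟨Y, hY, rfl⟩ := hX
  exact ⟨phi n Y, phi_mem_so n hY, by simp⟩

lemma conj_mem_m (n : ℕ) (h : H n) {X : Mat n} (hX : X ∈ m n) :
    (h : Mat n) * (X * (h : Mat n)ᵀ) ∈ m n := by
  obtain ⟨Y, hY, rfl⟩ := hX
  refine ⟨(h : Mat n) * (Y * (h : Mat n)ᵀ), ?_, ?_⟩
  · have hY' := (show (Y)ᵀ = -Y from hY)
    change (_)ᵀ = -_
    simp [Matrix.transpose_mul, hY', Matrix.mul_assoc]
  · have e := H_comm_B n h
    have e' : (B n)ᵀ * (h : Mat n)ᵀ = (h : Mat n)ᵀ * (B n)ᵀ := by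
      rw [← Matrix.transpose_mul, ← Matrix.transpose_mul, e]
    simp only [LinearMap.sub_apply, LinearMap.id_apply, phi_apply, Matrix.mul_sub, Matrix.sub_mul]
    congr 1
    calc B n * ((h : Mat n) * (Y * (h : Mat n)ᵀ) * (B n)ᵀ)
        = (B n * (h : Mat n)) * Y * ((h : Mat n)ᵀ * (B n)ᵀ) := by simp only [Matrix.mul_assoc]
      _ = _ := by rw [← e, ← e']; simp only [Matrix.mul_assoc]

/-- The isotropy representation of `H` on `𝔪`: `Ad(h) X = h X h⁻¹`. -/
def Ad (n : ℕ) (h : H n) : Module.End ℝ (m n) where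
  toFun X := ⟨(h : Mat n) * ((X : Mat n) * (h : Mat n)ᵀ), conj_mem_m n h X.2⟩
  map_add' X Y := Subtype.ext (by simp [Matrix.mul_add, Matrix.add_mul])
  map_smul' c X := Subtype.ext (by simp)

/-- The algebra `𝒜` of invariant affinor structures on `M`: the endomorphisms of `𝔪` that commute
with `Ad(H)`. -/
def Affinor (n : ℕ) : Subalgebra ℝ (Module.End ℝ (m n)) :=
  Subalgebra.centralizer ℝ (Set.range (Ad n))

instance (n : ℕ) : Ring (Affinor n) :=
  @Subalgebra.toRing ℝ (Module.End ℝ (m n)) _ Module.End.instRing _ (Affinor n)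

attribute [local instance] Matrix.normedAddCommGroup Matrix.normedSpace

/-! ### Smooth functions and vector fields on `M`

`SO(n)` is a compact submanifold of the space of matrices, so a function on it is smooth iff it
is the restriction of a smooth function of matrices. A function on `M = G/H` is smooth iff its
pull-back to `G` is. The tangent bundle of `M` is `G ×_H 𝔪`, the class of `(g, ξ)` being the
velocity at `t = 0` of the curve `g exp(tξ) H`; so a vector field on `M` is a map `X : G → 𝔪`
with `X(gh) = Ad(h⁻¹) X(g)`. Under this description the action of `G` on `M` sends
the class of `(g, ξ)` to that of `(ag, ξ)`, so invariant tensor fields are `Ad(H)`-invariant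
tensors on `𝔪`, applied pointwise. -/

/-- Smoothness of a function on `SO(n)`. -/
def IsSmooth {n : ℕ} {V : Type*} [NormedAddCommGroup V] [NormedSpace ℝ V] (F : G n → V) : Prop :=
  ∃ F' : Mat n → V, ContDiff ℝ ∞ F' ∧ ∀ g : G n, F' (g : Mat n) = F g

/-- The algebra `C^∞(M)`. -/
def SmoothFun (n : ℕ) : Subalgebra ℝ (M n → ℝ) where
  carrier := {u | IsSmooth fun g : G n => u (g : M n)}
  mul_mem' := by
    rintro u v ⟨u', hu, eu⟩ ⟨v', hv, ev⟩
    exact ⟨fun A => u' A * v' A, hu.mul hv, fun g => by simp [eu, ev]⟩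
  add_mem' := by
    rintro u v ⟨u', hu, eu⟩ ⟨v', hv, ev⟩
    exact ⟨fun A => u' A + v' A, hu.add hv, fun g => by simp [eu, ev]⟩
  algebraMap_mem' r := ⟨fun _ => r, contDiff_const, fun _ => rfl⟩

/-- The space `𝔛(M)` of smooth vector fields on `M`. -/
def VectorField (n : ℕ) : Submodule ℝ (G n → m n) where
  carrier := {X | IsSmooth X ∧ ∀ (g : G n) (h : H n), X (g * h) = Ad n h⁻¹ (X g)}
  zero_mem' := ⟨⟨fun _ => 0, contDiff_const, fun _ => rfl⟩, fun _ _ => by simp⟩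
  add_mem' := by
    rintro X Y ⟨⟨X', hX, eX⟩, hX'⟩ ⟨⟨Y', hY, eY⟩, hY'⟩
    exact ⟨⟨fun A => X' A + Y' A, hX.add hY, fun g => by simp [eX, eY]⟩,
      fun g h => by simp [hX', hY']⟩
  smul_mem' := by
    rintro c X ⟨⟨X', hX, eX⟩, hX'⟩
    exact ⟨⟨fun A => c • X' A, hX.const_smul c, fun g => by simp [eX]⟩,
      fun g h => by simp [hX']⟩

/-- The product `u X` of a smooth function and a vector field. -/
def fsmul {n : ℕ} (u : SmoothFun n) (X : VectorField n) : VectorField n :=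
  ⟨fun g => u.1 (g : M n) • X.1 g, by
    obtain ⟨u, u', hu, eu⟩ := u
    obtain ⟨X, ⟨X', hX, eX⟩, hX'⟩ := X
    refine ⟨⟨fun A => u' A • X' A, hu.smul hX, fun g => by simp [eu, eX]⟩, fun g h => ?_⟩
    have e : ((g * (h : G n) : G n) : M n) = (g : M n) := QuotientGroup.mk_mul_of_mem g h.2
    simp [e, hX']⟩

/-- The exponential map of `SO(n)`, on `𝔪`. -/
def expG {n : ℕ} (ξ : m n) : G n :=
  ⟨NormedSpace.exp (ξ : Mat n), by
    have key : ∀ Y : Mat n, Yᵀ = -Y → NormedSpace.exp Y * (NormedSpace.exp Y)ᵀ = 1 := by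
      intro Y hY
      rw [← Matrix.exp_transpose, hY,
        ← Matrix.exp_add_of_commute _ _ ((Commute.refl Y).neg_right), add_neg_cancel,
        NormedSpace.exp_zero]
    have hξ := (show (ξ : Mat n)ᵀ = -(ξ : Mat n) from m_le_so n ξ.2)
    rw [Matrix.mem_specialOrthogonalGroup_iff, Matrix.mem_orthogonalGroup_iff]
    refine ⟨key _ hξ, ?_⟩
    set Y : Mat n := (2⁻¹ : ℝ) • (ξ : Mat n) with hYdef
    have hY : Yᵀ = -Y := by simp [hYdef, hξ]
    have h2 : (ξ : Mat n) = Y + Y := by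
      rw [hYdef, ← add_smul]; norm_num
    have h1 := congrArg Matrix.det (key Y hY)
    rw [Matrix.det_mul, Matrix.det_transpose, Matrix.det_one] at h1
    rw [h2, Matrix.exp_add_of_commute _ _ (Commute.refl Y), Matrix.det_mul, h1]⟩

lemma expG_Ad {n : ℕ} (h : H n) (ξ : m n) :
    expG (Ad n h ξ) = (h : G n) * expG ξ * (h : G n)⁻¹ := by
  apply Subtype.ext
  change NormedSpace.exp ((h : Mat n) * ((ξ : Mat n) * (h : Mat n)ᵀ))
    = (h : Mat n) * NormedSpace.exp (ξ : Mat n) * (((h : G n)⁻¹ : G n) : Mat n)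
  have hinv : ((h : G n) : Mat n)⁻¹ = ((h : G n) : Mat n)ᵀ :=
    Matrix.inv_eq_right_inv (coe_mul_transpose n h)
  have hu : IsUnit ((h : G n) : Mat n) :=
    (Matrix.isUnit_iff_isUnit_det _).2 (by
      rw [(Matrix.mem_specialOrthogonalGroup_iff.1 (h : G n).2).2]; exact isUnit_one)
  rw [coe_inv, ← hinv, ← Matrix.exp_conj _ _ hu, Matrix.mul_assoc]

/-- The derivative `X u` of a function `u` on `M` along a vector field `X`: its value at `gH` is
the derivative at `t = 0` of `u (g exp(t X(g)) H)`. -/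
def der {n : ℕ} (X : VectorField n) (u : M n → ℝ) : M n → ℝ := fun p =>
  Quotient.liftOn' p
    (fun g : G n => deriv (fun t : ℝ => u ((g * expG (t • X.1 g) : G n) : M n)) 0) (by
    intro a b hab
    have hab' : a⁻¹ * b ∈ H n := QuotientGroup.leftRel_apply.1 hab
    obtain ⟨h, rfl⟩ : ∃ h : H n, b = a * h := ⟨⟨_, hab'⟩, by simp⟩
    change deriv _ 0 = deriv _ 0
    congr 1
    funext t
    rw [X.2.2 a h, ← map_smul, expG_Ad]
    congr 1
    have e : a * (h : G n) * (((h⁻¹ : H n) : G n) * expG (t • X.1 a) * ((h⁻¹ : H n) : G n)⁻¹)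
        = a * expG (t • X.1 a) * (h : G n) := by
      simp [mul_assoc]
    rw [e]
    exact (QuotientGroup.mk_mul_of_mem _ h.2).symm)

/-! ### Invariant Riemannian metrics and the Levi-Civita connection -/

/-- An invariant Riemannian metric on `M`: an `Ad(H)`-invariant inner product on `𝔪`. -/
structure InvariantMetric (n : ℕ) where
  form : LinearMap.BilinForm ℝ (m n)
  symm : ∀ X Y, form X Y = form Y X
  pos : ∀ X, X ≠ 0 → 0 < form X X
  inv : ∀ (h : H n) (X Y), form (Ad n h X) (Ad n h Y) = form X Y

/-- The function `⟨X, Y⟩` on `M` for vector fields `X`, `Y`. -/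
def InvariantMetric.pair {n : ℕ} (g : InvariantMetric n) (X Y : VectorField n) : M n → ℝ := fun p =>
  Quotient.liftOn' p (fun a : G n => g.form (X.1 a) (Y.1 a)) (by
    intro a b hab
    have hab' : a⁻¹ * b ∈ H n := QuotientGroup.leftRel_apply.1 hab
    obtain ⟨h, rfl⟩ : ∃ h : H n, b = a * h := ⟨⟨_, hab'⟩, by simp⟩
    change g.form (X.1 a) (Y.1 a) = g.form (X.1 (a * h)) (Y.1 (a * h))
    rw [X.2.2 a h, Y.2.2 a h, g.inv])

/-- `D X Y = ∇_X Y` is the Levi-Civita connection of `g`: an affine connection on `M` that is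
compatible with `g` and torsion-free. -/
structure IsLeviCivita {n : ℕ} (g : InvariantMetric n)
    (D : VectorField n → VectorField n → VectorField n) : Prop where
  add_left : ∀ X X' Y, D (X + X') Y = D X Y + D X' Y
  smul_left : ∀ u X Y, D (fsmul u X) Y = fsmul u (D X Y)
  add_right : ∀ X Y Y', D X (Y + Y') = D X Y + D X Y'
  leibniz : ∀ (X : VectorField n) (u : SmoothFun n) (Y : VectorField n) (a : G n),
    (D X (fsmul u Y)).1 a = der X u.1 (a : M n) • Y.1 a + u.1 (a : M n) • (D X Y).1 a
  metric : ∀ X Y Z, der X (g.pair Y Z) = g.pair (D X Y) Z + g.pair Y (D X Z)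
  torsion_free : ∀ (X Y : VectorField n) (u : SmoothFun n),
    der (D X Y) u.1 - der (D Y X) u.1 = der X (der Y u.1) - der Y (der X u.1)

/-! ### Invariant affinor structures, canonical structures -/

/-- The action of an invariant affinor structure on vector fields. -/
def act {n : ℕ} (F : Affinor n) (X : VectorField n) : VectorField n :=
  ⟨fun a => F.1 (X.1 a), by
    obtain ⟨X, ⟨X', hX, eX⟩, hX'⟩ := X
    refine ⟨⟨fun A => F.1 (X' A), ?_, fun a => by simp [eX]⟩, fun a h => ?_⟩
    · exact (LinearMap.toContinuousLinearMap F.1).contDiff.comp hX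
    · have hc : Ad n h⁻¹ * F.1 = F.1 * Ad n h⁻¹ :=
        Subalgebra.mem_centralizer_iff ℝ |>.1 F.2 _ ⟨h⁻¹, rfl⟩
      have := LinearMap.congr_fun hc (X a)
      simp only [Module.End.mul_apply] at this
      change F.1 (X (a * h)) = Ad n h⁻¹ (F.1 (X a))
      rw [hX', this]⟩

/-- `θ`, the restriction of `φ` to `𝔪`. -/
def theta (n : ℕ) : Affinor n :=
  ⟨(phi n).restrict fun _ hX => phi_mem_m n hX, by
    refine (Subalgebra.mem_centralizer_iff ℝ).2 ?_
    rintro _ ⟨h, rfl⟩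
    refine LinearMap.ext fun X => Subtype.ext ?_
    have e := H_comm_B n h
    have e' : (B n)ᵀ * (h : Mat n)ᵀ = (h : Mat n)ᵀ * (B n)ᵀ := by
      rw [← Matrix.transpose_mul, ← Matrix.transpose_mul, e]
    change (h : Mat n) * (phi n X * (h : Mat n)ᵀ)
      = phi n ((h : Mat n) * ((X : Mat n) * (h : Mat n)ᵀ))
    rw [phi_apply, phi_apply]
    calc (h : Mat n) * (B n * ((X : Mat n) * (B n)ᵀ) * (h : Mat n)ᵀ)
        = (h : Mat n) * B n * (X : Mat n) * ((B n)ᵀ * (h : Mat n)ᵀ) := by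
          simp only [Matrix.mul_assoc]
      _ = _ := by rw [e, e']; simp only [Matrix.mul_assoc]⟩

/-- An invariant affinor structure is canonical if it is a polynomial in `θ`. -/
def IsCanonical {n : ℕ} (F : Affinor n) : Prop :=
  ∃ p : Polynomial ℝ, F = Polynomial.aeval (theta n) p

/-- `f`-structures: `f³ + f = 0`. -/
def IsFStructure {n : ℕ} (F : Affinor n) : Prop := F ^ 3 + F = 0

/-- The structure `f₀ = (θ - θ³) / 2`. -/
def f0 (n : ℕ) : Affinor n := (1 / 2 : ℝ) • (theta n - theta n ^ 3)

/-! ### Classes of metric `f`-structures -/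

/-- Metric `f`-structures: `⟨fX, Y⟩ + ⟨X, fY⟩ = 0`. -/
def IsMetricF {n : ℕ} (g : InvariantMetric n) (F : Affinor n) : Prop :=
  IsFStructure F ∧ ∀ X Y : VectorField n, g.pair (act F X) Y + g.pair X (act F Y) = 0

/-- `∇_X(f) Y = ∇_X (fY) - f (∇_X Y)`. -/
def nablaF {n : ℕ} (D : VectorField n → VectorField n → VectorField n) (F : Affinor n)
    (X Y : VectorField n) : VectorField n :=
  D X (act F Y) - act F (D X Y)

/-- The composition tensor `T(X, Y) = ¼ f(∇_{fX}(f) fY - ∇_{f²X}(f) f²Y)`. -/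
def compTensor {n : ℕ} (D : VectorField n → VectorField n → VectorField n) (F : Affinor n)
    (X Y : VectorField n) : VectorField n :=
  (1 / 4 : ℝ) • act F (nablaF D F (act F X) (act F Y)
    - nablaF D F (act F (act F X)) (act F (act F Y)))

/-- Killing `f`-structures: metric `f`-structures with `∇_X(f) X = 0`, where `∇` is the (unique)
Levi-Civita connection. -/
def IsKillingF {n : ℕ} (g : InvariantMetric n) (F : Affinor n) : Prop :=
  IsMetricF g F ∧ ∃ D, IsLeviCivita g D ∧ ∀ X, nablaF D F X X = 0

/-- Nearly Kähler `f`-structures: metric `f`-structures with `∇_{fX}(f) fX = 0`. -/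
def IsNKF {n : ℕ} (g : InvariantMetric n) (F : Affinor n) : Prop :=
  IsMetricF g F ∧ ∃ D, IsLeviCivita g D ∧ ∀ X, nablaF D F (act F X) (act F X) = 0

/-- `G₁f`-structures: metric `f`-structures with `T(X, X) = 0`. -/
def IsG1F {n : ℕ} (g : InvariantMetric n) (F : Affinor n) : Prop :=
  IsMetricF g F ∧ ∃ D, IsLeviCivita g D ∧ ∀ X, compTensor D F X X = 0

/-! ### Characteristic numbers -/

/-- `𝔪₁`: the rows and columns `1` and `{2, 3}`. -/
def m1 (n : ℕ) : Set (m n) := {X | ∃ a : Matrix (Fin 1) (Fin 2) ℝ,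
  (X : Mat n) = Matrix.fromBlocks 0 (Matrix.fromCols a 0) (Matrix.fromRows (-aᵀ) 0) 0}

/-- `𝔪₂`: the rows and columns `{2, 3}` and `{4, …, n}`. -/
def m2 (n : ℕ) : Set (m n) := {X | ∃ c : Matrix (Fin 2) (Fin (n - 3)) ℝ,
  (X : Mat n) = Matrix.fromBlocks 0 0 0 (Matrix.fromBlocks 0 c (-cᵀ) 0)}

/-- `𝔪₃`: the rows and columns `1` and `{4, …, n}`. -/
def m3 (n : ℕ) : Set (m n) := {X | ∃ b : Matrix (Fin 1) (Fin (n - 3)) ℝ,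
  (X : Mat n) = Matrix.fromBlocks 0 (Matrix.fromCols 0 b) (Matrix.fromRows 0 (-bᵀ)) 0}

/-- The inner product `tr(XᵀY)` on `𝔪`, a positive multiple of minus the Killing form of `so(n)`.
(The multiple is immaterial here.) -/
def g0 {n : ℕ} (X Y : m n) : ℝ := Matrix.trace ((X : Mat n)ᵀ * (Y : Mat n))

/-- `(s, t)` are the characteristic numbers of `g`: up to a positive factor `c`,
`g = g₀|𝔪₁ + s g₀|𝔪₂ + t g₀|𝔪₃` with respect to `𝔪 = 𝔪₁ ⊕ 𝔪₂ ⊕ 𝔪₃`. -/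
def HasCharacteristicNumbers {n : ℕ} (g : InvariantMetric n) (s t : ℝ) : Prop :=
  ∃ c : ℝ, 0 < c ∧ ∀ X₁ ∈ m1 n, ∀ X₂ ∈ m2 n, ∀ X₃ ∈ m3 n, ∀ Y₁ ∈ m1 n, ∀ Y₂ ∈ m2 n, ∀ Y₃ ∈ m3 n,
    g.form (X₁ + X₂ + X₃) (Y₁ + Y₂ + Y₃) = c * (g0 X₁ Y₁ + s * g0 X₂ Y₂ + t * g0 X₃ Y₃)

end FlagSpace

end

/-!
The tangent bundle of `M = SO(n) / (SO(2) × SO(n-3))` is `G ×_H 𝔪`, so vector fields are equivariant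
functions `SO(n) → 𝔪`. Differentiating them along left-invariant fields is the canonical connection
(`canonicalConn`), for which all invariant tensors are parallel and whose torsion is
`-[X, Y]_𝔪`. Adding the invariant tensor `Λ` given by the Koszul formula
`2⟨Λ(X, Y), Z⟩ = ⟨[X, Y]_𝔪, Z⟩ - ⟨[Y, Z]_𝔪, X⟩ + ⟨[Z, X]_𝔪, Y⟩` (`lam`) gives a Levi-Civita
connection (`isLeviCivita_lcConn`), and it is the only one (`IsLeviCivita.eq_lcConn`): the functions
`gH ↦ g B gᵀ` separate tangent vectors, so the difference of two such connections is symmetric in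
its arguments, as well as skew for the metric. Hence `∇_X(f)Y = Λ(X, fY) - fΛ(X, Y)`, and the three
classes of `f`-structures are described by algebraic conditions on `𝔪`.

A point of `𝔪 = 𝔪₁ ⊕ 𝔪₂ ⊕ 𝔪₃` is a triple of blocks `(a, c, b)`; the brackets are
`[𝔪₁, 𝔪₂] ⊆ 𝔪₃`, `[𝔪₂, 𝔪₃] ⊆ 𝔪₁`, `[𝔪₁, 𝔪₃] ⊆ 𝔪₂` modulo the isotropy algebra, and `f₀` is
`(a, c, b) ↦ (-aJ, -Jc, 0)`.

* The element `diag(1, -1, 1)` of `H` shows `𝔪₃ ⟂ 𝔪₁ ⊕ 𝔪₂` for every invariant metric. Since `f₀`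
  acts on `𝔪₁` as an element of `Ad(H)` and on `𝔪₂` as minus the same element, `f₀` is metric iff
  `𝔪₁ ⟂ 𝔪₂`, which is automatic for `n ≥ 5`. The metric on `𝔪₁` and on `𝔪₃` is a multiple of the
  trace form (`form_m1`, `form_m3`).
* If `f₀` is metric, `Λ(f₀X, f₀Y) ∈ 𝔪₃ = ker f₀`, so `f₀` is a `G₁f`-structure
  (`isG1F_of_isMetricF`).
* For `n = 5` the metric on `𝔪₂` need not be a multiple of the trace form. But the nearly Kähler
  condition says that `ad 𝔪₃` is skew on `𝔪₁ ⊕ 𝔪₂`, and `[𝔪₁, 𝔪₃] = 𝔪₂` transports the metric from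
  `𝔪₁` to `𝔪₂` (`isBlockForm_of_isNKF`); this gives characteristic numbers `(1, t)`.
* For a metric `α tr ⊕ σ tr ⊕ τ tr`, every term of `⟨∇_X(f₀)X, Z⟩` is a multiple of a single
  trilinear form (`form_nabla_of_isBlockForm`). The Killing condition, given `α = σ`, becomes
  `4α = 3τ`.

Finally `θ` is a complex structure on `𝔪₁ ⊕ 𝔪₂` and `-1` on `𝔪₃`, so that a polynomial in `θ` is a
pair of a complex number `z` and a real number `r`; it is an `f`-structure iff `z³ + z = 0` and
`r³ + r = 0`, that is, `z ∈ {0, i, -i}` and `r = 0`.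
-/

noncomputable section

namespace FlagSpace

attribute [local instance] Matrix.normedAddCommGroup Matrix.normedSpace

/-! ### Block coordinates on `𝔪` -/

/-- The `2 × 2` block `(0 1; -1 0)` of `B`. -/
def J : Matrix (Fin 2) (Fin 2) ℝ := !![0, 1; -1, 0]

lemma J_mul_J : J * J = -1 := by
  ext i j; fin_cases i <;> fin_cases j <;> simp [J, Matrix.mul_apply, Fin.sum_univ_two]

lemma J_transpose : Jᵀ = -J := by
  ext i j; fin_cases i <;> fin_cases j <;> simp [J]

lemma J_mem : J ∈ Matrix.specialOrthogonalGroup (Fin 2) ℝ :=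
  Matrix.mem_specialOrthogonalGroup_fin_two_iff.2 (by simp [J])

lemma B_eq (n : ℕ) : B n = blockDiag n J (-1) := rfl

/-- The skew-symmetric matrix with upper off-diagonal blocks `a`, `c`, `b` (between the index sets
`{1}` and `{2, 3}`, `{2, 3}` and `{4, …, n}`, `{1}` and `{4, …, n}`) and zero diagonal blocks. -/
def skewMat {n : ℕ} (a : Matrix (Fin 1) (Fin 2) ℝ) (c : Matrix (Fin 2) (Fin (n - 3)) ℝ)
    (b : Matrix (Fin 1) (Fin (n - 3)) ℝ) : Mat n :=
  Matrix.fromBlocks 0 (Matrix.fromCols a b) (Matrix.fromRows (-aᵀ) (-bᵀ))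
    (Matrix.fromBlocks 0 c (-cᵀ) 0)

lemma skewMat_mem_so {n : ℕ} (a : Matrix (Fin 1) (Fin 2) ℝ) (c : Matrix (Fin 2) (Fin (n - 3)) ℝ)
    (b : Matrix (Fin 1) (Fin (n - 3)) ℝ) : skewMat a c b ∈ so n := by
  change (_)ᵀ = -_
  ext i j
  rcases i with i | i | i <;> rcases j with j | j | j <;> simp [skewMat]

lemma blockDiag_conj_skewMat {n : ℕ} (a : Matrix (Fin 1) (Fin 2) ℝ)
    (c : Matrix (Fin 2) (Fin (n - 3)) ℝ) (b : Matrix (Fin 1) (Fin (n - 3)) ℝ)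
    (R : Matrix (Fin 2) (Fin 2) ℝ) (C : Matrix (Fin (n - 3)) (Fin (n - 3)) ℝ) :
    blockDiag n R C * (skewMat a c b * (blockDiag n R C)ᵀ)
      = skewMat (a * Rᵀ) (R * c * Cᵀ) (b * Cᵀ) := by
  rw [blockDiag_transpose]
  simp [blockDiag, skewMat, Matrix.fromBlocks_multiply, Matrix.fromCols_mul_fromBlocks,
    Matrix.fromBlocks_mul_fromRows, Matrix.mul_assoc]

lemma phi_skewMat {n : ℕ} (a : Matrix (Fin 1) (Fin 2) ℝ)
    (c : Matrix (Fin 2) (Fin (n - 3)) ℝ) (b : Matrix (Fin 1) (Fin (n - 3)) ℝ) :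
    phi n (skewMat a c b) = skewMat (-(a * J)) (-(J * c)) (-b) := by
  rw [phi_apply, B_eq, blockDiag_conj_skewMat, J_transpose]
  simp

lemma skewMat_mem_m {n : ℕ} (a : Matrix (Fin 1) (Fin 2) ℝ) (c : Matrix (Fin 2) (Fin (n - 3)) ℝ)
    (b : Matrix (Fin 1) (Fin (n - 3)) ℝ) : skewMat a c b ∈ m n := by
  -- `(J - 1) / 2` is the inverse of `-(J + 1)`, since `J ^ 2 = -1`
  refine ⟨skewMat ((1 / 2 : ℝ) • (a * (J - 1))) ((1 / 2 : ℝ) • ((J - 1) * c))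
    (-(1 / 2 : ℝ) • b), skewMat_mem_so _ _ _, ?_⟩
  rw [LinearMap.sub_apply, phi_skewMat, LinearMap.id_apply]
  have ha : -((1 / 2 : ℝ) • (a * (J - 1)) * J) - (1 / 2 : ℝ) • (a * (J - 1)) = a := by
    rw [Matrix.mul_sub, Matrix.smul_mul, Matrix.sub_mul, Matrix.mul_assoc, J_mul_J]
    simp only [Matrix.mul_one, Matrix.mul_neg]
    module
  have hc : -(J * ((1 / 2 : ℝ) • ((J - 1) * c))) - (1 / 2 : ℝ) • ((J - 1) * c) = c := by
    rw [Matrix.sub_mul, Matrix.mul_smul, Matrix.mul_sub, ← Matrix.mul_assoc, J_mul_J]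
    simp only [Matrix.one_mul, Matrix.neg_mul]
    module
  have hb : -(-(1 / 2 : ℝ) • b) - (-(1 / 2 : ℝ) • b) = b := by module
  have hsub : ∀ (a a' : Matrix (Fin 1) (Fin 2) ℝ) (c c' : Matrix (Fin 2) (Fin (n - 3)) ℝ)
      (b b' : Matrix (Fin 1) (Fin (n - 3)) ℝ),
      skewMat a c b - skewMat a' c' b' = skewMat (a - a') (c - c') (b - b') := by
    intros
    ext i j
    rcases i with i | i | i <;> rcases j with j | j | j <;> simp [skewMat] <;> ring
  rw [hsub, ha, hc, hb]

/-- The block between `{1}` and `{2, 3}`. -/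
def blockA (n : ℕ) : Mat n →ₗ[ℝ] Matrix (Fin 1) (Fin 2) ℝ where
  toFun X := X.toBlocks₁₂.toCols₁
  map_add' _ _ := rfl
  map_smul' _ _ := rfl

/-- The block between `{2, 3}` and `{4, …, n}`. -/
def blockC (n : ℕ) : Mat n →ₗ[ℝ] Matrix (Fin 2) (Fin (n - 3)) ℝ where
  toFun X := X.toBlocks₂₂.toBlocks₁₂
  map_add' _ _ := rfl
  map_smul' _ _ := rfl

/-- The block between `{1}` and `{4, …, n}`. -/
def blockB (n : ℕ) : Mat n →ₗ[ℝ] Matrix (Fin 1) (Fin (n - 3)) ℝ where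
  toFun X := X.toBlocks₁₂.toCols₂
  map_add' _ _ := rfl
  map_smul' _ _ := rfl

@[simp] lemma blockA_fromBlocks {n : ℕ} (P : Matrix (Fin 1) (Fin 1) ℝ)
    (a : Matrix (Fin 1) (Fin 2) ℝ) (b : Matrix (Fin 1) (Fin (n - 3)) ℝ)
    (Q : Matrix (Fin 2 ⊕ Fin (n - 3)) (Fin 1) ℝ)
    (S : Matrix (Fin 2 ⊕ Fin (n - 3)) (Fin 2 ⊕ Fin (n - 3)) ℝ) :
    blockA n (Matrix.fromBlocks P (Matrix.fromCols a b) Q S) = a := rfl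

@[simp] lemma blockB_fromBlocks {n : ℕ} (P : Matrix (Fin 1) (Fin 1) ℝ)
    (a : Matrix (Fin 1) (Fin 2) ℝ) (b : Matrix (Fin 1) (Fin (n - 3)) ℝ)
    (Q : Matrix (Fin 2 ⊕ Fin (n - 3)) (Fin 1) ℝ)
    (S : Matrix (Fin 2 ⊕ Fin (n - 3)) (Fin 2 ⊕ Fin (n - 3)) ℝ) :
    blockB n (Matrix.fromBlocks P (Matrix.fromCols a b) Q S) = b := rfl

@[simp] lemma blockC_fromBlocks {n : ℕ} (P : Matrix (Fin 1) (Fin 1) ℝ)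
    (S : Matrix (Fin 1) (Fin 2 ⊕ Fin (n - 3)) ℝ) (Q : Matrix (Fin 2 ⊕ Fin (n - 3)) (Fin 1) ℝ)
    (W : Matrix (Fin 2) (Fin 2) ℝ) (c : Matrix (Fin 2) (Fin (n - 3)) ℝ)
    (Y : Matrix (Fin (n - 3)) (Fin 2) ℝ) (Z : Matrix (Fin (n - 3)) (Fin (n - 3)) ℝ) :
    blockC n (Matrix.fromBlocks P S Q (Matrix.fromBlocks W c Y Z)) = c := rfl

lemma eq_skewMat_of_mem {n : ℕ} {X : Mat n} (hX : X ∈ m n) :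
    X = skewMat (blockA n X) (blockC n X) (blockB n X) := by
  have hs : ∀ i j, X j i = - X i j := fun i j => congrFun (congrFun (m_le_so n hX) i) j
  obtain ⟨Y, hY, hYX⟩ := hX
  have hYs : ∀ i j, Y j i = - Y i j := fun i j => congrFun (congrFun hY i) j
  have hXY : ∀ i j, X i j = (B n * (Y * (B n)ᵀ)) i j - Y i j := by
    intro i j
    rw [← hYX, LinearMap.sub_apply, phi_apply]; rfl
  have h11 : ∀ i j, X (Sum.inl i) (Sum.inl j) = 0 := by
    intro i j
    have := hs (Sum.inl i) (Sum.inl j)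
    rw [Subsingleton.elim j i] at this ⊢
    linarith
  have h22 : ∀ i j, X (Sum.inr (Sum.inl i)) (Sum.inr (Sum.inl j)) = 0 := by
    intro i j
    rw [hXY]
    have h0 := hYs (Sum.inr (Sum.inl 0)) (Sum.inr (Sum.inl 0))
    have h1 := hYs (Sum.inr (Sum.inl 1)) (Sum.inr (Sum.inl 1))
    have h01 := hYs (Sum.inr (Sum.inl 0)) (Sum.inr (Sum.inl 1))
    fin_cases i <;> fin_cases j <;>
      simp [B, blockDiag, Matrix.mul_apply, Fin.sum_univ_two] <;> linarith
  have h33 : ∀ i j, X (Sum.inr (Sum.inr i)) (Sum.inr (Sum.inr j)) = 0 := by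
    intro i j
    rw [hXY]
    simp [B, blockDiag, Matrix.mul_apply, Matrix.one_apply]
  ext i j
  rcases i with i | i | i <;> rcases j with j | j | j
  all_goals first
    | simp [skewMat, h11]; done
    | simp [skewMat, h22]; done
    | simp [skewMat, h33]; done
    | rfl
    | exact hs _ _

/-- The point of `𝔪` with blocks `a`, `c`, `b`, that is, with components `a`, `c`, `b` in `𝔪₁`,
`𝔪₂`, `𝔪₃`. -/
def ofBlocks {n : ℕ} (a : Matrix (Fin 1) (Fin 2) ℝ) (c : Matrix (Fin 2) (Fin (n - 3)) ℝ)
    (b : Matrix (Fin 1) (Fin (n - 3)) ℝ) : m n :=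
  ⟨skewMat a c b, skewMat_mem_m a c b⟩

@[simp] lemma coe_ofBlocks {n : ℕ} (a : Matrix (Fin 1) (Fin 2) ℝ)
    (c : Matrix (Fin 2) (Fin (n - 3)) ℝ) (b : Matrix (Fin 1) (Fin (n - 3)) ℝ) :
    (ofBlocks a c b : Mat n) = skewMat a c b := rfl

lemma ofBlocks_surj {n : ℕ} (X : m n) : ∃ a c b, X = ofBlocks a c b :=
  ⟨_, _, _, Subtype.ext (eq_skewMat_of_mem X.2)⟩

lemma ofBlocks_inj {n : ℕ} {a a' : Matrix (Fin 1) (Fin 2) ℝ}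
    {c c' : Matrix (Fin 2) (Fin (n - 3)) ℝ} {b b' : Matrix (Fin 1) (Fin (n - 3)) ℝ} :
    ofBlocks a c b = ofBlocks a' c' b' ↔ a = a' ∧ c = c' ∧ b = b' := by
  refine ⟨fun h => ?_, ?_⟩
  · have h := congrArg (Subtype.val) h
    exact ⟨congrArg (blockA n) h, congrArg (blockC n) h, congrArg (blockB n) h⟩
  · rintro ⟨rfl, rfl, rfl⟩; rfl

lemma ofBlocks_add {n : ℕ} (a a' : Matrix (Fin 1) (Fin 2) ℝ) (c c' : Matrix (Fin 2) (Fin (n - 3)) ℝ)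
    (b b' : Matrix (Fin 1) (Fin (n - 3)) ℝ) :
    ofBlocks a c b + ofBlocks a' c' b' = ofBlocks (a + a') (c + c') (b + b') := by
  apply Subtype.ext
  ext i j
  rcases i with i | i | i <;> rcases j with j | j | j <;> simp [skewMat] <;> ring

lemma ofBlocks_smul {n : ℕ} (r : ℝ) (a : Matrix (Fin 1) (Fin 2) ℝ)
    (c : Matrix (Fin 2) (Fin (n - 3)) ℝ) (b : Matrix (Fin 1) (Fin (n - 3)) ℝ) :
    r • ofBlocks a c b = ofBlocks (r • a) (r • c) (r • b) := by
  apply Subtype.ext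
  ext i j
  rcases i with i | i | i <;> rcases j with j | j | j <;> simp [skewMat]

lemma ofBlocks_neg {n : ℕ} (a : Matrix (Fin 1) (Fin 2) ℝ)
    (c : Matrix (Fin 2) (Fin (n - 3)) ℝ) (b : Matrix (Fin 1) (Fin (n - 3)) ℝ) :
    -ofBlocks a c b = ofBlocks (-a) (-c) (-b) := by
  rw [← neg_one_smul ℝ, ofBlocks_smul]
  simp only [neg_one_smul]

lemma ofBlocks_sub {n : ℕ} (a a' : Matrix (Fin 1) (Fin 2) ℝ) (c c' : Matrix (Fin 2) (Fin (n - 3)) ℝ)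
    (b b' : Matrix (Fin 1) (Fin (n - 3)) ℝ) :
    ofBlocks a c b - ofBlocks a' c' b' = ofBlocks (a - a') (c - c') (b - b') := by
  rw [sub_eq_add_neg, ofBlocks_neg, ofBlocks_add, ← sub_eq_add_neg, ← sub_eq_add_neg,
    ← sub_eq_add_neg]

@[simp] lemma ofBlocks_zero {n : ℕ} : (ofBlocks 0 0 0 : m n) = 0 := by
  have := ofBlocks_smul (n := n) 0 0 0 0
  simpa using this.symm

lemma ofBlocks_eq_add {n : ℕ} (a : Matrix (Fin 1) (Fin 2) ℝ)
    (c : Matrix (Fin 2) (Fin (n - 3)) ℝ) (b : Matrix (Fin 1) (Fin (n - 3)) ℝ) :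
    ofBlocks a c b = ofBlocks a 0 0 + ofBlocks 0 c 0 + ofBlocks 0 0 b := by
  simp [ofBlocks_add]

/-- The projection of matrices onto `𝔪` that forgets all but the upper off-diagonal blocks; on
`so(n)` it is the projection along the isotropy algebra `so(2) ⊕ so(n-3)`. -/
def proj (n : ℕ) : Mat n →ₗ[ℝ] m n where
  toFun X := ofBlocks (blockA n X) (blockC n X) (blockB n X)
  map_add' X Y := by simp [ofBlocks_add]
  map_smul' r X := by simp [ofBlocks_smul]

lemma proj_coe {n : ℕ} (X : m n) : proj n (X : Mat n) = X :=
  Subtype.ext (eq_skewMat_of_mem X.2).symm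

/-- A matrix `diag(1, R, C)` in `H`. -/
def mkH (n : ℕ) (R : Matrix (Fin 2) (Fin 2) ℝ) (C : Matrix (Fin (n - 3)) (Fin (n - 3)) ℝ)
    (hR : R ∈ Matrix.specialOrthogonalGroup (Fin 2) ℝ)
    (hC : C ∈ Matrix.specialOrthogonalGroup (Fin (n - 3)) ℝ) : H n :=
  ⟨⟨blockDiag n R C, by
    obtain ⟨hR1, hR2⟩ := Matrix.mem_specialOrthogonalGroup_iff.1 hR
    obtain ⟨hC1, hC2⟩ := Matrix.mem_specialOrthogonalGroup_iff.1 hC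
    rw [Matrix.mem_orthogonalGroup_iff] at hR1 hC1
    change R * Rᵀ = 1 at hR1
    change C * Cᵀ = 1 at hC1
    rw [Matrix.mem_specialOrthogonalGroup_iff, Matrix.mem_orthogonalGroup_iff]
    constructor
    · change blockDiag n R C * (blockDiag n R C)ᵀ = 1
      rw [blockDiag_transpose, blockDiag_mul, hR1, hC1, blockDiag_one]
    · rw [blockDiag, Matrix.det_fromBlocks_zero₂₁, Matrix.det_fromBlocks_zero₂₁, hR2, hC2]
      simp⟩, R, hR, C, hC, rfl⟩

lemma Ad_mkH_ofBlocks {n : ℕ} {R : Matrix (Fin 2) (Fin 2) ℝ}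
    {C : Matrix (Fin (n - 3)) (Fin (n - 3)) ℝ}
    (hR : R ∈ Matrix.specialOrthogonalGroup (Fin 2) ℝ)
    (hC : C ∈ Matrix.specialOrthogonalGroup (Fin (n - 3)) ℝ) (a : Matrix (Fin 1) (Fin 2) ℝ)
    (c : Matrix (Fin 2) (Fin (n - 3)) ℝ) (b : Matrix (Fin 1) (Fin (n - 3)) ℝ) :
    Ad n (mkH n R C hR hC) (ofBlocks a c b) = ofBlocks (a * Rᵀ) (R * c * Cᵀ) (b * Cᵀ) :=
  Subtype.ext (blockDiag_conj_skewMat a c b R C)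

lemma proj_conj {n : ℕ} (h : H n) (X : Mat n) :
    proj n ((h : Mat n) * (X * (h : Mat n)ᵀ)) = Ad n h (proj n X) := by
  obtain ⟨h, R, hR, C, hC, e⟩ := h
  apply Subtype.ext
  change _ = (h : Mat n) * (skewMat _ _ _ * (h : Mat n)ᵀ)
  simp only [e]
  rw [blockDiag_conj_skewMat]
  change skewMat _ _ _ = _
  have key : ∀ X : Mat n, X = Matrix.fromBlocks X.toBlocks₁₁
      (Matrix.fromCols (blockA n X) (blockB n X))
      (Matrix.fromRows X.toBlocks₂₁.toRows₁ X.toBlocks₂₁.toRows₂)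
      (Matrix.fromBlocks X.toBlocks₂₂.toBlocks₁₁ (blockC n X) X.toBlocks₂₂.toBlocks₂₁
        X.toBlocks₂₂.toBlocks₂₂) := by
    intro X
    ext i j
    rcases i with i | i | i <;> rcases j with j | j | j <;> rfl
  generalize hA : blockA n X = a
  generalize hB' : blockB n X = b
  generalize hC' : blockC n X = c
  have kX := key X
  rw [hA, hB', hC'] at kX
  rw [kX, blockDiag_transpose]
  simp [blockDiag, Matrix.fromBlocks_multiply, Matrix.fromCols_mul_fromBlocks,
    Matrix.mul_assoc]

/-! ### The `𝔪`-component of the bracket -/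

/-- The bilinear map `(X, Y) ↦ [X, Y]_𝔪`. -/
def brm (n : ℕ) : m n →ₗ[ℝ] m n →ₗ[ℝ] m n :=
  LinearMap.mk₂ ℝ (fun X Y => proj n ((X : Mat n) * (Y : Mat n) - (Y : Mat n) * (X : Mat n)))
    (fun X X' Y => by
      rw [← map_add]; congr 1; simp only [Submodule.coe_add, Matrix.add_mul, Matrix.mul_add]; abel)
    (fun r X Y => by
      rw [← map_smul]; congr 1
      simp only [Submodule.coe_smul, Matrix.smul_mul, Matrix.mul_smul, smul_sub])
    (fun X Y Y' => by
      rw [← map_add]; congr 1; simp only [Submodule.coe_add, Matrix.add_mul, Matrix.mul_add]; abel)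
    (fun r X Y => by
      rw [← map_smul]; congr 1
      simp only [Submodule.coe_smul, Matrix.smul_mul, Matrix.mul_smul, smul_sub])

lemma brm_apply {n : ℕ} (X Y : m n) :
    brm n X Y = proj n ((X : Mat n) * (Y : Mat n) - (Y : Mat n) * (X : Mat n)) := rfl

lemma brm_swap {n : ℕ} (X Y : m n) : brm n Y X = -brm n X Y := by
  rw [brm_apply, brm_apply, ← map_neg, neg_sub]

lemma brm_Ad {n : ℕ} (h : H n) (X Y : m n) :
    brm n (Ad n h X) (Ad n h Y) = Ad n h (brm n X Y) := by
  rw [brm_apply, brm_apply, ← proj_conj]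
  congr 1
  have e := coe_transpose_mul n h
  have key : ∀ X Y : Mat n, (h : Mat n) * (X * (h : Mat n)ᵀ) * ((h : Mat n) * (Y * (h : Mat n)ᵀ))
      = (h : Mat n) * (X * Y * (h : Mat n)ᵀ) := by
    intro X Y
    calc _ = (h : Mat n) * (X * (((h : Mat n)ᵀ * (h : Mat n)) * (Y * (h : Mat n)ᵀ))) := by
          simp only [Matrix.mul_assoc]
      _ = _ := by rw [e, Matrix.one_mul]; simp only [Matrix.mul_assoc]
  change (h : Mat n) * (X * (h : Mat n)ᵀ) * ((h : Mat n) * (Y * (h : Mat n)ᵀ)) -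
    (h : Mat n) * (Y * (h : Mat n)ᵀ) * ((h : Mat n) * (X * (h : Mat n)ᵀ)) = _
  rw [key, key, ← Matrix.mul_sub, ← Matrix.sub_mul]

lemma brm_ofBlocks {n : ℕ} (a a' : Matrix (Fin 1) (Fin 2) ℝ)
    (c c' : Matrix (Fin 2) (Fin (n - 3)) ℝ) (b b' : Matrix (Fin 1) (Fin (n - 3)) ℝ) :
    brm n (ofBlocks a c b) (ofBlocks a' c' b') =
      ofBlocks (b' * cᵀ - b * c'ᵀ) (a'ᵀ * b - aᵀ * b') (a * c' - a' * c) := by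
  rw [brm_apply]
  change ofBlocks _ _ _ = _
  rw [ofBlocks_inj]
  simp only [coe_ofBlocks, skewMat, Matrix.fromBlocks_multiply, map_sub,
    Matrix.fromCols_mul_fromBlocks, Matrix.fromBlocks_mul_fromRows,
    Matrix.fromRows_mul_fromCols, Matrix.fromBlocks_add]
  simp
  refine ⟨?_, ?_⟩ <;> abel

lemma theta_ofBlocks {n : ℕ} (a : Matrix (Fin 1) (Fin 2) ℝ)
    (c : Matrix (Fin 2) (Fin (n - 3)) ℝ) (b : Matrix (Fin 1) (Fin (n - 3)) ℝ) :
    (theta n).1 (ofBlocks a c b) = ofBlocks (-(a * J)) (-(J * c)) (-b) :=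
  Subtype.ext (phi_skewMat a c b)

lemma f0_ofBlocks {n : ℕ} (a : Matrix (Fin 1) (Fin 2) ℝ)
    (c : Matrix (Fin 2) (Fin (n - 3)) ℝ) (b : Matrix (Fin 1) (Fin (n - 3)) ℝ) :
    (f0 n).1 (ofBlocks a c b) = ofBlocks (-(a * J)) (-(J * c)) 0 := by
  have h : (f0 n).1 (ofBlocks a c b) = (1 / 2 : ℝ) • ((theta n).1 (ofBlocks a c b)
      - (theta n).1 ((theta n).1 ((theta n).1 (ofBlocks a c b)))) := rfl
  rw [h]
  simp only [theta_ofBlocks]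
  rw [ofBlocks_sub, ofBlocks_smul, ofBlocks_inj]
  have ha : a * J * J * J = -(a * J) := by
    rw [Matrix.mul_assoc a, J_mul_J]; simp
  have hc : J * (J * (J * c)) = -(J * c) := by
    rw [← Matrix.mul_assoc J J, J_mul_J]; simp
  simp only [Matrix.neg_mul, Matrix.mul_neg, neg_neg, ha, hc]
  refine ⟨by module, by module, by simp⟩

/-! ### Derivatives along left-invariant fields -/

section ExpOfMatrices

-- The exponential series and derivatives depend only on the topology, so any complete algebra
-- norm may be used here.
attribute [-instance] Matrix.normedAddCommGroup Matrix.normedSpace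
attribute [local instance] Matrix.linftyOpNormedRing Matrix.linftyOpNormedAlgebra

lemma hasDerivAt_exp_smul_matrix {n : ℕ} (Y : Mat n) :
    HasDerivAt (fun t : ℝ => NormedSpace.exp (t • Y)) Y 0 := by
  have := hasDerivAt_exp_smul_const (𝕂 := ℝ) Y 0
  rw [zero_smul, NormedSpace.exp_zero, one_mul] at this
  exact this

lemma exp_mul_eq_self {n : ℕ} {Z E : Mat n} (h : Z * E = 0) : NormedSpace.exp Z * E = E := by
  have h' : SemiconjBy E 0 Z := by rw [SemiconjBy, Matrix.mul_zero, h]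
  have := h'.exp_right
  rw [NormedSpace.exp_zero, SemiconjBy, mul_one] at this
  exact this.symm

end ExpOfMatrices

lemma exp_mem_specialOrthogonalGroup {n : ℕ} {Z : Mat n} (hZ : Z ∈ so n) :
    NormedSpace.exp Z ∈ Matrix.specialOrthogonalGroup (Ix n) ℝ := by
  have key : ∀ Y : Mat n, Y ∈ so n → NormedSpace.exp Y * (NormedSpace.exp Y)ᵀ = 1 := by
    intro Y hY
    rw [← Matrix.exp_transpose, show Yᵀ = -Y from hY,
      ← Matrix.exp_add_of_commute _ _ ((Commute.refl Y).neg_right), add_neg_cancel,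
      NormedSpace.exp_zero]
  rw [Matrix.mem_specialOrthogonalGroup_iff, Matrix.mem_orthogonalGroup_iff]
  refine ⟨key Z hZ, ?_⟩
  -- the determinant is a square, namely of that of `exp (Z / 2)`
  have h2 : Z = (2⁻¹ : ℝ) • Z + (2⁻¹ : ℝ) • Z := by module
  have h1 := congrArg Matrix.det (key _ ((so n).smul_mem (2⁻¹ : ℝ) hZ))
  rw [Matrix.det_mul, Matrix.det_transpose, Matrix.det_one] at h1
  rw [h2, Matrix.exp_add_of_commute _ _ (Commute.refl _), Matrix.det_mul, h1]

/-- The chain rule along the curve `A exp(tY)`. -/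
lemma hasDerivAt_comp_mul_exp {n : ℕ} {V : Type*} [NormedAddCommGroup V] [NormedSpace ℝ V]
    {F : Mat n → V} (hF : ContDiff ℝ ∞ F) (A Y : Mat n) :
    HasDerivAt (fun t : ℝ => F (A * NormedSpace.exp (t • Y))) (fderiv ℝ F A (A * Y)) 0 := by
  have h1 : HasDerivAt (fun t : ℝ => A * NormedSpace.exp (t • Y)) (A * Y) 0 :=
    ((LinearMap.mulLeft ℝ A).toContinuousLinearMap.hasFDerivAt).comp_hasDerivAt (0 : ℝ)
      (hasDerivAt_exp_smul_matrix Y)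
  have h2 : HasFDerivAt F (fderiv ℝ F A) (A * NormedSpace.exp ((0 : ℝ) • Y)) := by
    rw [zero_smul, NormedSpace.exp_zero, Matrix.mul_one]
    exact (hF.differentiable (by simp) A).hasFDerivAt
  exact h2.comp_hasDerivAt (0 : ℝ) h1

lemma deriv_comp_mul_expG {n : ℕ} {V : Type*} [NormedAddCommGroup V] [NormedSpace ℝ V]
    {F' : Mat n → V} (hF : ContDiff ℝ ∞ F') {F : G n → V} (e : ∀ g : G n, F' (g : Mat n) = F g)
    (a : G n) (ξ : m n) :
    deriv (fun t : ℝ => F (a * expG (t • ξ))) 0 = fderiv ℝ F' (a : Mat n) ((a : Mat n) * ξ) := by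
  rw [← (hasDerivAt_comp_mul_exp hF (a : Mat n) (ξ : Mat n)).deriv]
  congr 1
  funext t
  rw [← e]
  rfl

lemma der_eq_fderiv {n : ℕ} {u : M n → ℝ} {u' : Mat n → ℝ} (hu : ContDiff ℝ ∞ u')
    (e : ∀ g : G n, u' (g : Mat n) = u (g : M n)) (X : VectorField n) (a : G n) :
    der X u (a : M n) = fderiv ℝ u' (a : Mat n) ((a : Mat n) * (X.1 a : Mat n)) :=
  deriv_comp_mul_expG hu (F := fun g : G n => u (g : M n)) e a (X.1 a)

lemma contDiff_bilin {V W U : Type*} [NormedAddCommGroup V] [NormedSpace ℝ V]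
    [FiniteDimensional ℝ V] [NormedAddCommGroup W] [NormedSpace ℝ W] [FiniteDimensional ℝ W]
    [NormedAddCommGroup U] [NormedSpace ℝ U] {n : ℕ} (L : V →ₗ[ℝ] W →ₗ[ℝ] U)
    {f : Mat n → V} {g : Mat n → W} (hf : ContDiff ℝ ∞ f) (hg : ContDiff ℝ ∞ g) :
    ContDiff ℝ ∞ fun A => L (f A) (g A) :=
  (L.toContinuousBilinearMap.contDiff.comp hf).clm_apply hg

lemma fderiv_bilin {V W U : Type*} [NormedAddCommGroup V] [NormedSpace ℝ V]
    [FiniteDimensional ℝ V] [NormedAddCommGroup W] [NormedSpace ℝ W] [FiniteDimensional ℝ W]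
    [NormedAddCommGroup U] [NormedSpace ℝ U] {n : ℕ} (L : V →ₗ[ℝ] W →ₗ[ℝ] U)
    {f : Mat n → V} {g : Mat n → W} {A : Mat n} {f' : Mat n →L[ℝ] V} {g' : Mat n →L[ℝ] W}
    (hf : HasFDerivAt f f' A) (hg : HasFDerivAt g g' A) (Y : Mat n) :
    fderiv ℝ (fun A => L (f A) (g A)) A Y = L (f' Y) (g A) + L (f A) (g' Y) := by
  have h : HasFDerivAt (fun A => L (f A) (g A)) _ A :=
    L.toContinuousBilinearMap.hasFDerivAt_of_bilinear hf hg
  rw [h.fderiv]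
  exact add_comm _ _

lemma contDiff_mul_coe {n : ℕ} {X' : Mat n → m n} (hX : ContDiff ℝ ∞ X') :
    ContDiff ℝ ∞ fun A : Mat n => A * (X' A : Mat n) :=
  contDiff_bilin (LinearMap.mul ℝ (Mat n)) contDiff_id
    ((m n).subtype.toContinuousLinearMap.contDiff.comp hX)

lemma fderiv_mul_coe {n : ℕ} {X' : Mat n → m n} (hX : ContDiff ℝ ∞ X') (A Y : Mat n) :
    fderiv ℝ (fun A : Mat n => A * (X' A : Mat n)) A Y
      = Y * (X' A : Mat n) + A * (fderiv ℝ X' A Y : Mat n) := by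
  have h : HasFDerivAt (fun A => (X' A : Mat n)) _ A :=
    (m n).subtype.toContinuousLinearMap.hasFDerivAt.comp A
      (hX.differentiable (by simp) A).hasFDerivAt
  exact fderiv_bilin (LinearMap.mul ℝ (Mat n)) (hasFDerivAt_id A) h Y

lemma contDiff_fderiv_mul {n : ℕ} {V : Type*} [NormedAddCommGroup V] [NormedSpace ℝ V]
    {u' : Mat n → V} (hu : ContDiff ℝ ∞ u') {X' : Mat n → m n} (hX : ContDiff ℝ ∞ X') :
    ContDiff ℝ ∞ fun A : Mat n => fderiv ℝ u' A (A * (X' A : Mat n)) :=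
  (hu.fderiv_right (m := ∞) (by simp)).clm_apply (contDiff_mul_coe hX)

lemma fderiv_fderiv_mul {n : ℕ} {u' : Mat n → ℝ} (hu : ContDiff ℝ ∞ u') {X' : Mat n → m n}
    (hX : ContDiff ℝ ∞ X') (A Y : Mat n) :
    fderiv ℝ (fun A : Mat n => fderiv ℝ u' A (A * (X' A : Mat n))) A Y
      = fderiv ℝ (fderiv ℝ u') A Y (A * (X' A : Mat n))
        + fderiv ℝ u' A (Y * (X' A : Mat n) + A * (fderiv ℝ X' A Y : Mat n)) := by
  have h1 := ((hu.fderiv_right (m := ∞) (by simp)).differentiable (by simp) A).hasFDerivAt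
  have h2 := ((contDiff_mul_coe hX).differentiable (by simp) A).hasFDerivAt
  have h : HasFDerivAt (fun A : Mat n => fderiv ℝ u' A (A * (X' A : Mat n))) _ A :=
    h1.clm_apply h2
  rw [h.fderiv, ← fderiv_mul_coe hX]
  exact add_comm _ _

lemma fderiv_comm {n : ℕ} {u' : Mat n → ℝ} (hu : ContDiff ℝ ∞ u') (A Y Z : Mat n) :
    fderiv ℝ (fderiv ℝ u') A Y Z = fderiv ℝ (fderiv ℝ u') A Z Y :=
  hu.contDiffAt.isSymmSndFDerivAt
    (by simpa using (WithTop.coe_le_coe.2 le_top : ((2 : ℕ∞) : WithTop ℕ∞) ≤ ∞)) Y Z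

/-! ### Vertical directions -/

lemma exists_diagonal_blocks_of_proj_eq_zero {n : ℕ} {Z : Mat n} (hZ : Z ∈ so n)
    (h : proj n Z = 0) :
    ∃ R C, Rᵀ = -R ∧ Z = Matrix.fromBlocks 0 0 0 (Matrix.fromBlocks R 0 0 C) := by
  have hs : ∀ i j, Z j i = - Z i j := fun i j => congrFun (congrFun hZ i) j
  rw [← ofBlocks_zero] at h
  obtain ⟨ha, hc, hb⟩ := ofBlocks_inj.1 h
  have ha : ∀ i j, Z (Sum.inl i) (Sum.inr (Sum.inl j)) = 0 :=
    fun i j => congrFun (congrFun ha i) j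
  have hb : ∀ i j, Z (Sum.inl i) (Sum.inr (Sum.inr j)) = 0 :=
    fun i j => congrFun (congrFun hb i) j
  have hc : ∀ i j, Z (Sum.inr (Sum.inl i)) (Sum.inr (Sum.inr j)) = 0 :=
    fun i j => congrFun (congrFun hc i) j
  refine ⟨Z.toBlocks₂₂.toBlocks₁₁, Z.toBlocks₂₂.toBlocks₂₂, ?_, ?_⟩
  · ext i j
    exact hs _ _
  · ext i j
    rcases i with i | i | i <;> rcases j with j | j | j
    · have := hs (Sum.inl i) (Sum.inl j)
      rw [Subsingleton.elim j i] at this ⊢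
      simp only [Matrix.fromBlocks_apply₁₁, Matrix.zero_apply]
      linarith
    all_goals first
      | rfl
      | simpa using ha _ _
      | simpa using hb _ _
      | simpa using hc _ _
      | simpa [ha] using hs (Sum.inl j) (Sum.inr (Sum.inl i))
      | simpa [hb] using hs (Sum.inl j) (Sum.inr (Sum.inr i))
      | simpa [hc] using hs (Sum.inr (Sum.inl j)) (Sum.inr (Sum.inr i))

/-- The one-parameter groups of the isotropy algebra stay in `H`. -/
lemma exp_mem_H {n : ℕ} {Z : Mat n} (hZ : Z ∈ so n) (h : proj n Z = 0) :
    (⟨NormedSpace.exp Z, exp_mem_specialOrthogonalGroup hZ⟩ : G n) ∈ H n := by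
  obtain ⟨R, C, hR, rfl⟩ := exists_diagonal_blocks_of_proj_eq_zero hZ h
  have hcomm : Commute (Matrix.fromBlocks 0 0 0 (Matrix.fromBlocks R 0 0 C) : Mat n) (B n) := by
    have hRJ : R * J = J * R := by
      have e := fun i j => congrFun (congrFun hR i) j
      have e00 := e 0 0
      have e11 := e 1 1
      have e01 := e 0 1
      simp at e00 e11 e01
      ext i j
      fin_cases i <;> fin_cases j <;> simp [J, Matrix.mul_apply, Fin.sum_univ_two] <;> linarith
    rw [Commute, SemiconjBy, B_eq, blockDiag]
    simp [Matrix.fromBlocks_multiply, hRJ]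
  refine mem_H_of_comm n _ (hcomm.exp_left) ?_
  have h0 : (Matrix.fromBlocks 0 0 0 (Matrix.fromBlocks R 0 0 C) : Mat n)
      * Matrix.fromBlocks 1 0 0 0 = 0 := by
    simp [Matrix.fromBlocks_multiply]
  have h1 := congrFun (congrFun (exp_mul_eq_self h0) (Sum.inl 0)) (Sum.inl 0)
  simpa [Matrix.mul_apply] using h1

lemma fderiv_vertical {n : ℕ} {u : M n → ℝ} {u' : Mat n → ℝ} (hu : ContDiff ℝ ∞ u')
    (e : ∀ g : G n, u' (g : Mat n) = u (g : M n)) (a : G n) {Z : Mat n} (hZ : Z ∈ so n)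
    (h : proj n Z = 0) : fderiv ℝ u' (a : Mat n) ((a : Mat n) * Z) = 0 := by
  rw [← (hasDerivAt_comp_mul_exp hu (a : Mat n) Z).deriv]
  have hc : (fun t : ℝ => u' ((a : Mat n) * NormedSpace.exp (t • Z))) = fun _ => u (a : M n) := by
    funext t
    have hm := exp_mem_H ((so n).smul_mem t hZ) (by rw [map_smul, h, smul_zero])
    have := e (a * ⟨NormedSpace.exp (t • Z), exp_mem_specialOrthogonalGroup
      ((so n).smul_mem t hZ)⟩)
    rw [QuotientGroup.mk_mul_of_mem _ hm] at this
    exact this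
  rw [hc, deriv_const]

lemma bracket_mem_so {n : ℕ} {X Y : Mat n} (hX : X ∈ so n) (hY : Y ∈ so n) :
    X * Y - Y * X ∈ so n := by
  change (_)ᵀ = -_
  rw [Matrix.transpose_sub, Matrix.transpose_mul, Matrix.transpose_mul,
    show Xᵀ = -X from hX, show Yᵀ = -Y from hY]
  simp

lemma fderiv_bracket {n : ℕ} {u : M n → ℝ} {u' : Mat n → ℝ} (hu : ContDiff ℝ ∞ u')
    (e : ∀ g : G n, u' (g : Mat n) = u (g : M n)) (a : G n) (X Y : m n) :
    fderiv ℝ u' (a : Mat n) ((a : Mat n) * ((X : Mat n) * Y - (Y : Mat n) * X))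
      = fderiv ℝ u' (a : Mat n) ((a : Mat n) * (brm n X Y : Mat n)) := by
  rw [← sub_eq_zero, ← map_sub, ← Matrix.mul_sub]
  refine fderiv_vertical hu e a ((so n).sub_mem (bracket_mem_so (m_le_so n X.2) (m_le_so n Y.2))
    (m_le_so n (brm n X Y).2)) ?_
  rw [map_sub, proj_coe, brm_apply, sub_self]

/-! ### Test functions and test fields -/

lemma contDiff_mul_B_mul_transpose (n : ℕ) : ContDiff ℝ ∞ fun A : Mat n => A * B n * Aᵀ :=
  contDiff_bilin (LinearMap.mul ℝ (Mat n))
    ((LinearMap.mulRight ℝ (B n)).toContinuousLinearMap.contDiff)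
    ((Matrix.transposeLinearEquiv (Ix n) (Ix n) ℝ ℝ).toLinearMap.toContinuousLinearMap.contDiff)

/-- The functions `gH ↦ (g B gᵀ) i j`: since `H` centralizes `B`, they are well-defined on `M`. -/
def testFun (n : ℕ) (i j : Ix n) : SmoothFun n :=
  ⟨fun p => Quotient.liftOn' p (fun g : G n => ((g : Mat n) * B n * (g : Mat n)ᵀ) i j) (by
    intro a b hab
    have hab' : a⁻¹ * b ∈ H n := QuotientGroup.leftRel_apply.1 hab
    obtain ⟨h, rfl⟩ : ∃ h : H n, b = a * h := ⟨⟨_, hab'⟩, by simp⟩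
    have e := H_comm_B n h
    have e' := coe_mul_transpose n h
    refine congrFun (congrFun (?_ : (a : Mat n) * B n * (a : Mat n)ᵀ = _) i) j
    change _ = (a : Mat n) * (h : Mat n) * B n * ((a : Mat n) * (h : Mat n))ᵀ
    calc _ = (a : Mat n) * (B n * ((h : Mat n) * (h : Mat n)ᵀ)) * (a : Mat n)ᵀ := by
          rw [e', Matrix.mul_one]
      _ = (a : Mat n) * (B n * (h : Mat n)) * (h : Mat n)ᵀ * (a : Mat n)ᵀ := by
          simp only [Matrix.mul_assoc]
      _ = _ := by rw [← e, Matrix.transpose_mul]; simp only [Matrix.mul_assoc]), by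
    exact ⟨fun A => (A * B n * Aᵀ) i j, (Matrix.entryLinearMap ℝ ℝ i
      j).toContinuousLinearMap.contDiff.comp (contDiff_mul_B_mul_transpose n), fun g => rfl⟩⟩

lemma eq_zero_of_neg_eq_self {V : Type*} [AddCommGroup V] [Module ℝ V] {x : V} (h : -x = x) :
    x = 0 := by
  have h2 : (2 : ℝ) • x = 0 := by rw [two_smul, add_eq_zero_iff_eq_neg, h]
  simpa using h2

lemma eq_zero_of_comm_B {n : ℕ} {X : m n} (h : (X : Mat n) * B n = B n * (X : Mat n)) : X = 0 := by
  have h1 : phi n (X : Mat n) = X := by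
    rw [phi_apply, ← Matrix.mul_assoc, ← h, Matrix.mul_assoc, B_mul_transpose, Matrix.mul_one]
  obtain ⟨a, c, b, rfl⟩ := ofBlocks_surj X
  rw [coe_ofBlocks, phi_skewMat] at h1
  have h2 : (ofBlocks (-(a * J)) (-(J * c)) (-b) : m n) = ofBlocks a c b := Subtype.ext h1
  obtain ⟨ha, hc, hb⟩ := ofBlocks_inj.1 h2
  have ha' : a = 0 := by
    have h3 : a * J * J = -a := by rw [Matrix.mul_assoc, J_mul_J]; simp
    have h4 : a * J = -a := by rw [← neg_eq_iff_eq_neg]; exact ha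
    rw [h4, Matrix.neg_mul, h4, neg_neg] at h3
    exact eq_zero_of_neg_eq_self h3.symm
  have hc' : c = 0 := by
    have h3 : J * (J * c) = -c := by rw [← Matrix.mul_assoc, J_mul_J]; simp
    have h4 : J * c = -c := by rw [← neg_eq_iff_eq_neg]; exact hc
    rw [h4, Matrix.mul_neg, h4, neg_neg] at h3
    exact eq_zero_of_neg_eq_self h3.symm
  rw [ha', hc', eq_zero_of_neg_eq_self hb, ofBlocks_zero]

/-- The test functions separate tangent vectors: along `X` the derivative of `g B gᵀ` at `g` is
`g [X, B] gᵀ`, and no non-zero element of `𝔪` commutes with `B`. -/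
lemma eq_of_der_eq {n : ℕ} {X Y : VectorField n}
    (h : ∀ u : SmoothFun n, der X u.1 = der Y u.1) : X = Y := by
  apply Subtype.ext
  funext a
  rw [← sub_eq_zero]
  have hC := contDiff_mul_B_mul_transpose n
  have hd : ∀ Z : m n, fderiv ℝ (fun A : Mat n => A * B n * Aᵀ) (a : Mat n) ((a : Mat n) * Z)
      = (a : Mat n) * ((Z : Mat n) * B n - B n * Z) * (a : Mat n)ᵀ := by
    intro Z
    have h1 := fderiv_bilin (LinearMap.mul ℝ (Mat n))
      ((LinearMap.mulRight ℝ (B n)).toContinuousLinearMap.hasFDerivAt (x := (a : Mat n)))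
      ((Matrix.transposeLinearEquiv (Ix n) (Ix n) ℝ
        ℝ).toLinearMap.toContinuousLinearMap.hasFDerivAt (x := (a : Mat n))) ((a : Mat n) * Z)
    refine h1.trans ?_
    change (a : Mat n) * (Z : Mat n) * B n * (a : Mat n)ᵀ
      + (a : Mat n) * B n * ((a : Mat n) * (Z : Mat n))ᵀ = _
    rw [Matrix.transpose_mul, show (Z : Mat n)ᵀ = -(Z : Mat n) from m_le_so n Z.2]
    simp only [Matrix.mul_sub, Matrix.sub_mul, Matrix.mul_assoc, Matrix.neg_mul, Matrix.mul_neg]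
    abel
  have hij : ∀ (Z : VectorField n) (i j : Ix n), der Z (testFun n i j).1 (a : M n)
      = ((a : Mat n) * ((Z.1 a : Mat n) * B n - B n * (Z.1 a : Mat n)) * (a : Mat n)ᵀ) i j := by
    intro Z i j
    let E := (Matrix.entryLinearMap ℝ ℝ i j : Mat n →ₗ[ℝ] ℝ).toContinuousLinearMap
    rw [der_eq_fderiv (u' := fun A => E (A * B n * Aᵀ)) (E.contDiff.comp hC) (fun g => rfl)]
    rw [← hd]
    have h2 : HasFDerivAt (fun A : Mat n => E (A * B n * Aᵀ)) _ (a : Mat n) :=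
      E.hasFDerivAt.comp (a : Mat n) (hC.differentiable (by simp) (a : Mat n)).hasFDerivAt
    rw [h2.fderiv]
    rfl
  apply eq_zero_of_comm_B
  have key : (a : Mat n) * ((X.1 a : Mat n) * B n - B n * (X.1 a : Mat n)) * (a : Mat n)ᵀ
      = (a : Mat n) * ((Y.1 a : Mat n) * B n - B n * (Y.1 a : Mat n)) * (a : Mat n)ᵀ := by
    ext i j
    rw [← hij, ← hij, h]
  have ha := coe_transpose_mul n a
  have key2 : ∀ W : Mat n, (a : Mat n)ᵀ * ((a : Mat n) * W * (a : Mat n)ᵀ) * (a : Mat n) = W := by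
    intro W
    calc _ = ((a : Mat n)ᵀ * (a : Mat n)) * W * ((a : Mat n)ᵀ * (a : Mat n)) := by
          simp only [Matrix.mul_assoc]
      _ = W := by rw [ha, Matrix.one_mul, Matrix.mul_one]
  have key3 := key2 ((X.1 a : Mat n) * B n - B n * (X.1 a : Mat n))
  rw [key, key2] at key3
  rw [Submodule.coe_sub, Matrix.sub_mul, Matrix.mul_sub, sub_eq_sub_iff_sub_eq_sub, ← key3]

/-- The vector field on `M` generated by `W`: its value at the class of `g` is the `𝔪`-component of
`g⁻¹ W g`. -/
def fundField {n : ℕ} (W : Mat n) : VectorField n :=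
  ⟨fun g => proj n ((g : Mat n)ᵀ * (W * (g : Mat n))), by
    constructor
    · refine ⟨fun A => proj n (Aᵀ * (W * A)), ?_, fun g => rfl⟩
      have h1 : ContDiff ℝ ∞ fun A : Mat n => Aᵀ * (W * A) :=
        contDiff_bilin (LinearMap.mul ℝ (Mat n))
          ((Matrix.transposeLinearEquiv (Ix n) (Ix n) ℝ
            ℝ).toLinearMap.toContinuousLinearMap.contDiff)
          ((LinearMap.mulLeft ℝ W).toContinuousLinearMap.contDiff)
      exact (proj n).toContinuousLinearMap.contDiff.comp h1
    · intro g h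
      have hinv : ((h⁻¹ : H n) : Mat n) = (h : Mat n)ᵀ := coe_inv n h
      have hmul : ((g * (h : G n) : G n) : Mat n) = (g : Mat n) * (h : Mat n) := rfl
      beta_reduce
      rw [← proj_conj, hinv, hmul, Matrix.transpose_mul, Matrix.transpose_transpose]
      simp only [Matrix.mul_assoc]⟩

lemma fundField_one {n : ℕ} (ξ : m n) : (fundField (ξ : Mat n)).1 1 = ξ := by
  change proj n ((1 : Mat n)ᵀ * ((ξ : Mat n) * (1 : Mat n))) = ξ
  rw [Matrix.transpose_one, Matrix.one_mul, Matrix.mul_one, proj_coe]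

/-! ### The Levi-Civita connection of an invariant metric -/

lemma InvariantMetric.nondegenerate {n : ℕ} (g : InvariantMetric n) : g.form.Nondegenerate := by
  refine ⟨fun X h => ?_, fun X h => ?_⟩ <;>
  · by_contra h0
    exact (g.pos X h0).ne' (h X)

lemma InvariantMetric.eq_of_form_eq {n : ℕ} (g : InvariantMetric n) {X Y : m n}
    (h : ∀ Z, g.form X Z = g.form Y Z) : X = Y := by
  rw [← sub_eq_zero]
  by_contra h0
  refine (g.pos _ h0).ne' ?_
  rw [LinearMap.map_sub₂, h, sub_self]

/-- The trilinear form of the Koszul formula,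
`½ (⟨[X, Y]_𝔪, Z⟩ - ⟨[Y, Z]_𝔪, X⟩ + ⟨[Z, X]_𝔪, Y⟩)`. -/
def koszul {n : ℕ} (g : InvariantMetric n) : m n →ₗ[ℝ] m n →ₗ[ℝ] Module.Dual ℝ (m n) :=
  LinearMap.mk₂ ℝ (fun X Y => (1 / 2 : ℝ) • (g.form (brm n X Y) - (g.form.flip X) ∘ₗ brm n Y
      + (g.form.flip Y) ∘ₗ (brm n).flip X))
    (fun X X' Y => by ext Z; simp; ring)
    (fun r X Y => by ext Z; simp; ring)
    (fun X Y Y' => by ext Z; simp; ring)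
    (fun r X Y => by ext Z; simp; ring)

/-- The tensorial part of the Levi-Civita connection: it is the bilinear map `Λ` on `𝔪` with
`⟨Λ(X, Y), Z⟩` given by the Koszul formula. -/
def lam {n : ℕ} (g : InvariantMetric n) : m n →ₗ[ℝ] m n →ₗ[ℝ] m n :=
  (koszul g).compr₂ (g.form.toDual g.nondegenerate).symm.toLinearMap

lemma form_lam {n : ℕ} (g : InvariantMetric n) (X Y Z : m n) :
    g.form (lam g X Y) Z = (1 / 2 : ℝ) * (g.form (brm n X Y) Z - g.form (brm n Y Z) X
      + g.form (brm n Z X) Y) := by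
  refine (LinearMap.BilinForm.apply_toDual_symm_apply (hB := g.nondegenerate)
    (koszul g X Y) Z).trans ?_
  simp [koszul]
  ring

lemma lam_sub_lam {n : ℕ} (g : InvariantMetric n) (X Y : m n) :
    lam g X Y - lam g Y X = brm n X Y := by
  refine g.eq_of_form_eq fun Z => ?_
  rw [map_sub, LinearMap.sub_apply, form_lam, form_lam, brm_swap X Y, brm_swap Y Z, brm_swap Z X]
  simp only [map_neg, LinearMap.neg_apply]
  ring

lemma form_lam_add {n : ℕ} (g : InvariantMetric n) (X Y Z : m n) :
    g.form (lam g X Y) Z + g.form Y (lam g X Z) = 0 := by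
  rw [g.symm Y, form_lam, form_lam, brm_swap X Y, brm_swap Y Z, brm_swap Z X]
  simp only [map_neg, LinearMap.neg_apply]
  ring

lemma Ad_mul_Ad_inv {n : ℕ} (h : H n) (X : m n) : Ad n h (Ad n h⁻¹ X) = X := by
  apply Subtype.ext
  have hinv : ((h⁻¹ : H n) : Mat n) = (h : Mat n)ᵀ := coe_inv n h
  have e := coe_mul_transpose n h
  change (h : Mat n) * (((h⁻¹ : H n) : Mat n) * ((X : Mat n) * ((h⁻¹ : H n) : Mat n)ᵀ)
    * (h : Mat n)ᵀ) = X
  rw [hinv, Matrix.transpose_transpose]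
  calc _ = ((h : Mat n) * (h : Mat n)ᵀ) * (X : Mat n) * ((h : Mat n) * (h : Mat n)ᵀ) := by
        simp only [Matrix.mul_assoc]
    _ = _ := by rw [e, Matrix.one_mul, Matrix.mul_one]

lemma lam_Ad {n : ℕ} (g : InvariantMetric n) (h : H n) (X Y : m n) :
    lam g (Ad n h X) (Ad n h Y) = Ad n h (lam g X Y) := by
  refine g.eq_of_form_eq fun Z => ?_
  obtain ⟨Z, rfl⟩ : ∃ W, Z = Ad n h W := ⟨_, (Ad_mul_Ad_inv h Z).symm⟩
  rw [g.inv, form_lam, form_lam, brm_Ad, brm_Ad, brm_Ad, g.inv, g.inv, g.inv]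

/-- An `Ad(H)`-equivariant bilinear map on `𝔪`, applied pointwise to vector fields. -/
def tensorField {n : ℕ} (L : m n →ₗ[ℝ] m n →ₗ[ℝ] m n)
    (hL : ∀ (h : H n) (X Y : m n), L (Ad n h X) (Ad n h Y) = Ad n h (L X Y))
    (X Y : VectorField n) : VectorField n :=
  ⟨fun a => L (X.1 a) (Y.1 a), by
    obtain ⟨X, ⟨X', hX, eX⟩, hX'⟩ := X
    obtain ⟨Y, ⟨Y', hY, eY⟩, hY'⟩ := Y
    exact ⟨⟨fun A => L (X' A) (Y' A), contDiff_bilin L hX hY, fun a => by simp [eX, eY]⟩,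
      fun a h => by simp [hX', hY', hL]⟩⟩

/-- The canonical connection of the reductive space: it differentiates the `𝔪`-valued function
`Y` on `SO(n)` along the left-invariant fields. -/
def canonicalConn {n : ℕ} (X Y : VectorField n) : VectorField n :=
  ⟨fun a => deriv (fun t : ℝ => Y.1 (a * expG (t • X.1 a))) 0, by
    obtain ⟨X, ⟨X', hX, eX⟩, hX'⟩ := X
    obtain ⟨Y, ⟨Y', hY, eY⟩, hY'⟩ := Y
    refine ⟨⟨fun A => fderiv ℝ Y' A (A * (X' A : Mat n)), contDiff_fderiv_mul hY hX,
      fun a => ?_⟩, fun a h => ?_⟩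
    · beta_reduce
      rw [eX]
      exact (deriv_comp_mul_expG hY eY a (X a)).symm
    · have e : ∀ t : ℝ, Y (a * h * expG (t • X (a * h))) = Ad n h⁻¹ (Y (a * expG (t • X a))) := by
        intro t
        rw [hX', ← map_smul, expG_Ad, ← hY']
        congr 1
        simp [mul_assoc]
      have hd : HasDerivAt (fun t : ℝ => Y (a * expG (t • X a)))
          (fderiv ℝ Y' (a : Mat n) ((a : Mat n) * (X a : Mat n))) 0 := by
        have e2 : (fun t : ℝ => Y (a * expG (t • X a)))
            = fun t : ℝ => Y' ((a : Mat n) * NormedSpace.exp (t • (X a : Mat n))) :=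
          funext fun t => (eY _).symm
        rw [e2]
        exact hasDerivAt_comp_mul_exp hY (a : Mat n) (X a : Mat n)
      have h2 : HasDerivAt (fun t : ℝ => Y (a * h * expG (t • X (a * h))))
          (Ad n h⁻¹ (fderiv ℝ Y' (a : Mat n) ((a : Mat n) * (X a : Mat n)))) 0 := by
        simp_rw [e]
        exact (LinearMap.toContinuousLinearMap (Ad n h⁻¹)).hasFDerivAt.comp_hasDerivAt (0 : ℝ) hd
      exact h2.deriv.trans (congrArg (Ad n h⁻¹) hd.deriv.symm)⟩

lemma canonicalConn_apply {n : ℕ} (X Y : VectorField n) {Y' : Mat n → m n}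
    (hY : ContDiff ℝ ∞ Y') (eY : ∀ a : G n, Y' (a : Mat n) = Y.1 a) (a : G n) :
    (canonicalConn X Y).1 a = fderiv ℝ Y' (a : Mat n) ((a : Mat n) * (X.1 a : Mat n)) :=
  deriv_comp_mul_expG hY eY a (X.1 a)

/-- The Levi-Civita connection of `g`. -/
def lcConn {n : ℕ} (g : InvariantMetric n) (X Y : VectorField n) : VectorField n :=
  canonicalConn X Y + tensorField (lam g) (lam_Ad g) X Y

lemma lcConn_apply {n : ℕ} (g : InvariantMetric n) (X Y : VectorField n) (a : G n) :
    (lcConn g X Y).1 a = (canonicalConn X Y).1 a + lam g (X.1 a) (Y.1 a) := rfl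

lemma lcConn_metric {n : ℕ} (g : InvariantMetric n) (X Y Z : VectorField n) :
    der X (g.pair Y Z) = g.pair (lcConn g X Y) Z + g.pair Y (lcConn g X Z) := by
  funext p
  induction p using QuotientGroup.induction_on with
  | H a =>
    obtain ⟨Y', hY, eY⟩ := Y.2.1
    obtain ⟨Z', hZ, eZ⟩ := Z.2.1
    rw [der_eq_fderiv (u' := fun A => g.form (Y' A) (Z' A)) (contDiff_bilin g.form hY hZ)
      (fun b => by rw [eY, eZ]; rfl)]
    have key : fderiv ℝ (fun A => g.form (Y' A) (Z' A)) (a : Mat n)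
        ((a : Mat n) * (X.1 a : Mat n)) = g.form ((canonicalConn X Y).1 a) (Z' (a : Mat n))
          + g.form (Y' (a : Mat n)) ((canonicalConn X Z).1 a) := by
      rw [canonicalConn_apply X Y hY eY, canonicalConn_apply X Z hZ eZ]
      exact fderiv_bilin g.form (hY.differentiable (by simp) (a : Mat n)).hasFDerivAt
        (hZ.differentiable (by simp) (a : Mat n)).hasFDerivAt _
    rw [key, eY, eZ]
    change _ = g.form ((lcConn g X Y).1 a) (Z.1 a) + g.form (Y.1 a) ((lcConn g X Z).1 a)
    rw [lcConn_apply, lcConn_apply, map_add, map_add, LinearMap.add_apply]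
    linear_combination -form_lam_add g (X.1 a) (Y.1 a) (Z.1 a)

lemma der_der {n : ℕ} (X Y : VectorField n) {u : M n → ℝ} {u' : Mat n → ℝ}
    (hu : ContDiff ℝ ∞ u') (e : ∀ g : G n, u' (g : Mat n) = u (g : M n)) (a : G n) :
    der X (der Y u) (a : M n)
      = fderiv ℝ (fderiv ℝ u') (a : Mat n) ((a : Mat n) * (X.1 a : Mat n))
          ((a : Mat n) * (Y.1 a : Mat n))
        + fderiv ℝ u' (a : Mat n) ((a : Mat n) * ((X.1 a : Mat n) * (Y.1 a : Mat n)))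
        + fderiv ℝ u' (a : Mat n) ((a : Mat n) * ((canonicalConn X Y).1 a : Mat n)) := by
  obtain ⟨Y', hY, eY⟩ := Y.2.1
  rw [der_eq_fderiv (u' := fun A => fderiv ℝ u' A (A * (Y' A : Mat n))) (contDiff_fderiv_mul hu hY)
    (fun b => by rw [eY, der_eq_fderiv hu e]), fderiv_fderiv_mul hu hY, eY,
    ← canonicalConn_apply X Y hY eY, map_add, Matrix.mul_assoc]
  ring

lemma lcConn_torsion_free {n : ℕ} (g : InvariantMetric n) (X Y : VectorField n)
    (u : SmoothFun n) :
    der (lcConn g X Y) u.1 - der (lcConn g Y X) u.1 = der X (der Y u.1) - der Y (der X u.1) := by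
  obtain ⟨u', hu, e⟩ := u.2
  funext p
  induction p using QuotientGroup.induction_on with
  | H a =>
    rw [Pi.sub_apply, Pi.sub_apply, der_der X Y hu e, der_der Y X hu e, fderiv_comm hu,
      der_eq_fderiv hu e, der_eq_fderiv hu e, lcConn_apply, lcConn_apply]
    have h1 := fderiv_bracket hu e a (X.1 a) (Y.1 a)
    rw [← lam_sub_lam g] at h1
    simp only [Submodule.coe_sub, Submodule.coe_add, Matrix.mul_add, Matrix.mul_sub, map_add,
      map_sub] at h1 ⊢
    linear_combination -h1

lemma isLeviCivita_lcConn {n : ℕ} (g : InvariantMetric n) : IsLeviCivita g (lcConn g) where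
  add_left X X' Y := by
    apply Subtype.ext
    funext a
    obtain ⟨Y', hY, eY⟩ := Y.2.1
    change (lcConn g (X + X') Y).1 a = (lcConn g X Y).1 a + (lcConn g X' Y).1 a
    simp only [lcConn_apply, canonicalConn_apply _ Y hY eY, Submodule.coe_add, Pi.add_apply,
      Matrix.mul_add, map_add, LinearMap.add_apply]
    abel
  smul_left u X Y := by
    apply Subtype.ext
    funext a
    obtain ⟨Y', hY, eY⟩ := Y.2.1
    change (lcConn g (fsmul u X) Y).1 a = u.1 (a : M n) • (lcConn g X Y).1 a
    simp only [lcConn_apply, canonicalConn_apply _ Y hY eY]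
    change fderiv ℝ Y' (a : Mat n) ((a : Mat n) * (u.1 (a : M n) • (X.1 a : Mat n)))
      + lam g (u.1 (a : M n) • X.1 a) (Y.1 a) = _
    rw [Matrix.mul_smul, map_smul, map_smul, LinearMap.smul_apply, smul_add]
  add_right X Y Z := by
    apply Subtype.ext
    funext a
    obtain ⟨Y', hY, eY⟩ := Y.2.1
    obtain ⟨Z', hZ, eZ⟩ := Z.2.1
    change (lcConn g X (Y + Z)).1 a = (lcConn g X Y).1 a + (lcConn g X Z).1 a
    have hd : HasFDerivAt (fun A => Y' A + Z' A) _ (a : Mat n) :=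
      (hY.differentiable (by simp) (a : Mat n)).hasFDerivAt.add
        (hZ.differentiable (by simp) (a : Mat n)).hasFDerivAt
    rw [lcConn_apply, lcConn_apply, lcConn_apply, canonicalConn_apply _ Y hY eY,
      canonicalConn_apply _ Z hZ eZ, canonicalConn_apply _ (Y + Z) (hY.add hZ)
        (fun b => by rw [eY, eZ]; rfl), hd.fderiv]
    change fderiv ℝ Y' (a : Mat n) _ + fderiv ℝ Z' (a : Mat n) _
      + lam g (X.1 a) (Y.1 a + Z.1 a) = _
    rw [map_add]
    abel
  leibniz X u Y a := by
    obtain ⟨Y', hY, eY⟩ := Y.2.1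
    obtain ⟨u', hu, e⟩ := u.2
    have hs : ContDiff ℝ ∞ fun A => LinearMap.lsmul ℝ (m n) (u' A) (Y' A) :=
      contDiff_bilin _ hu hY
    rw [der_eq_fderiv hu e, lcConn_apply, lcConn_apply, canonicalConn_apply _ Y hY eY,
      canonicalConn_apply _ (fsmul u Y) hs (fun b => by rw [eY, e]; rfl)]
    have key : fderiv ℝ (fun A => LinearMap.lsmul ℝ (m n) (u' A) (Y' A)) (a : Mat n)
        ((a : Mat n) * (X.1 a : Mat n))
        = fderiv ℝ u' (a : Mat n) ((a : Mat n) * (X.1 a : Mat n)) • Y' (a : Mat n)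
          + u' (a : Mat n) • fderiv ℝ Y' (a : Mat n) ((a : Mat n) * (X.1 a : Mat n)) :=
      fderiv_bilin _ (hu.differentiable (by simp) (a : Mat n)).hasFDerivAt
        (hY.differentiable (by simp) (a : Mat n)).hasFDerivAt _
    have hv : (fsmul u Y).1 a = u.1 (a : M n) • Y.1 a := rfl
    rw [key, eY, e, hv, map_smul, smul_add, add_assoc]
  metric := lcConn_metric g
  torsion_free := lcConn_torsion_free g

lemma pair_mk {n : ℕ} (g : InvariantMetric n) (X Y : VectorField n) (a : G n) :
    g.pair X Y (a : M n) = g.form (X.1 a) (Y.1 a) := rfl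

lemma der_sub_left {n : ℕ} (X Y : VectorField n) (u : SmoothFun n) :
    der (X - Y) u.1 = der X u.1 - der Y u.1 := by
  obtain ⟨u', hu, e⟩ := u.2
  funext p
  induction p using QuotientGroup.induction_on with
  | H a =>
    rw [Pi.sub_apply, der_eq_fderiv hu e, der_eq_fderiv hu e, der_eq_fderiv hu e, ← map_sub,
      ← Matrix.mul_sub]
    rfl

/-- The Levi-Civita connection is unique: the difference `S` of two of them satisfies
`S(X, Y) = S(Y, X)` and `⟨S(X, Y), Z⟩ = -⟨Y, S(X, Z)⟩`, so it vanishes. -/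
lemma IsLeviCivita.eq_lcConn {n : ℕ} {g : InvariantMetric n}
    {D : VectorField n → VectorField n → VectorField n} (hD : IsLeviCivita g D) :
    D = lcConn g := by
  have hsymm : ∀ X Y, D X Y - D Y X = lcConn g X Y - lcConn g Y X := by
    intro X Y
    refine eq_of_der_eq fun u => ?_
    rw [der_sub_left, der_sub_left, hD.torsion_free, lcConn_torsion_free]
  funext X Y
  apply Subtype.ext
  funext a
  set s : VectorField n → VectorField n → m n :=
    fun X Y => (D X Y).1 a - (lcConn g X Y).1 a with hs
  have h1 : ∀ X Y, s X Y = s Y X := fun X Y =>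
    sub_eq_sub_iff_sub_eq_sub.2 (congrFun (congrArg Subtype.val (hsymm X Y)) a)
  have h2 : ∀ X Y Z : VectorField n, g.form (s X Y) (Z.1 a) = - g.form (s X Z) (Y.1 a) := by
    intro X Y Z
    have := congrFun ((hD.metric X Y Z).symm.trans (lcConn_metric g X Y Z)) (a : M n)
    simp only [Pi.add_apply, pair_mk] at this
    simp only [hs, map_sub, LinearMap.sub_apply]
    rw [g.symm (Y.1 a), g.symm (Y.1 a)] at this
    linarith
  -- a trilinear form symmetric in `(X, Y)` and skew in `(Y, Z)` vanishes
  have h3 : ∀ X Y Z : VectorField n, g.form (s X Y) (Z.1 a) = 0 := by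
    intro X Y Z
    have e1 := h2 X Y Z
    have e2 := h2 Z X Y
    have e3 := h2 Y Z X
    rw [h1 X Z] at e1
    rw [h1 Z Y] at e2
    rw [h1 Y X] at e3
    linarith
  have h4 := h3 X Y (D X Y - lcConn g X Y)
  have h5 : s X Y = 0 := by
    by_contra h0
    exact (g.pos _ h0).ne' h4
  exact sub_eq_zero.1 h5

/-! ### The covariant derivative of an invariant affinor structure -/

lemma canonicalConn_act {n : ℕ} (F : Affinor n) (X Y : VectorField n) :
    canonicalConn X (act F Y) = act F (canonicalConn X Y) := by
  apply Subtype.ext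
  funext a
  obtain ⟨Y', hY, eY⟩ := Y.2.1
  let L := LinearMap.toContinuousLinearMap F.1
  have hd : HasFDerivAt (fun A => L (Y' A)) _ (a : Mat n) :=
    L.hasFDerivAt.comp (a : Mat n) (hY.differentiable (by simp) (a : Mat n)).hasFDerivAt
  change _ = F.1 ((canonicalConn X Y).1 a)
  rw [canonicalConn_apply X (act F Y) (Y' := fun A => L (Y' A)) (L.contDiff.comp hY)
    (fun b => by rw [eY]; rfl), canonicalConn_apply X Y hY eY, hd.fderiv]
  rfl

/-- The covariant derivative of an invariant affinor structure is a tensor: invariant affinor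
structures are parallel for the canonical connection. -/
lemma nablaF_lcConn {n : ℕ} (g : InvariantMetric n) (F : Affinor n) (X Y : VectorField n)
    (a : G n) : (nablaF (lcConn g) F X Y).1 a
      = lam g (X.1 a) (F.1 (Y.1 a)) - F.1 (lam g (X.1 a) (Y.1 a)) := by
  have h1 : (nablaF (lcConn g) F X Y).1 a = (lcConn g X (act F Y)).1 a
    - F.1 ((lcConn g X Y).1 a) := rfl
  have h2 : (act F (canonicalConn X Y)).1 a = F.1 ((canonicalConn X Y).1 a) := rfl
  rw [h1, lcConn_apply, lcConn_apply, canonicalConn_act, map_add, h2]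
  have h3 : (act F Y).1 a = F.1 (Y.1 a) := rfl
  rw [h3]
  abel

lemma isMetricF_iff {n : ℕ} (g : InvariantMetric n) (F : Affinor n) :
    IsMetricF g F ↔ IsFStructure F ∧ ∀ X Y : m n, g.form (F.1 X) Y + g.form X (F.1 Y) = 0 := by
  refine and_congr_right fun _ => ⟨fun h X Y => ?_, fun h X Y => ?_⟩
  · have := congrFun (h (fundField (X : Mat n)) (fundField (Y : Mat n))) ((1 : G n) : M n)
    rw [← fundField_one X, ← fundField_one Y]
    exact this
  · funext p
    induction p using QuotientGroup.induction_on with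
    | H a => exact h (X.1 a) (Y.1 a)

lemma isKillingF_iff {n : ℕ} (g : InvariantMetric n) (F : Affinor n) :
    IsKillingF g F ↔ IsMetricF g F ∧ ∀ X : m n, lam g X (F.1 X) = F.1 (lam g X X) := by
  refine and_congr_right fun _ => ⟨?_, fun h => ⟨lcConn g, isLeviCivita_lcConn g, fun X => ?_⟩⟩
  · rintro ⟨D, hD, h⟩ X
    rw [hD.eq_lcConn] at h
    have := congrFun (congrArg Subtype.val (h (fundField (X : Mat n)))) 1
    rw [nablaF_lcConn, fundField_one] at this
    exact sub_eq_zero.1 this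
  · apply Subtype.ext
    funext a
    rw [nablaF_lcConn, h, sub_self]
    rfl

lemma isNKF_iff {n : ℕ} (g : InvariantMetric n) (F : Affinor n) :
    IsNKF g F ↔ IsMetricF g F ∧
      ∀ X : m n, lam g (F.1 X) (F.1 (F.1 X)) = F.1 (lam g (F.1 X) (F.1 X)) := by
  refine and_congr_right fun _ => ⟨?_, fun h => ⟨lcConn g, isLeviCivita_lcConn g, fun X => ?_⟩⟩
  · rintro ⟨D, hD, h⟩ X
    rw [hD.eq_lcConn] at h
    have := congrFun (congrArg Subtype.val (h (fundField (X : Mat n)))) 1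
    have e : (act F (fundField (X : Mat n))).1 1 = F.1 X := congrArg F.1 (fundField_one X)
    rw [nablaF_lcConn, e] at this
    exact sub_eq_zero.1 this
  · apply Subtype.ext
    funext a
    rw [nablaF_lcConn]
    exact sub_eq_zero.2 (h (X.1 a))

lemma isG1F_of {n : ℕ} (g : InvariantMetric n) (F : Affinor n) (hF : IsMetricF g F)
    (h : ∀ X Y : m n, F.1 (lam g (F.1 X) (F.1 Y)) = 0) : IsG1F g F := by
  refine ⟨hF, lcConn g, isLeviCivita_lcConn g, fun X => ?_⟩
  apply Subtype.ext
  funext a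
  change (1 / 4 : ℝ) • F.1 ((nablaF (lcConn g) F (act F X) (act F X)).1 a
    - (nablaF (lcConn g) F (act F (act F X)) (act F (act F X))).1 a) = 0
  rw [nablaF_lcConn, nablaF_lcConn]
  have e : ∀ Y : VectorField n, (act F Y).1 a = F.1 (Y.1 a) := fun _ => rfl
  simp only [e, map_sub, h, sub_zero, smul_zero]

/-! ### Inner products and the invariant trilinear form in block coordinates -/

/-- The inner product `tr(xᵀ y)` of rectangular matrices. -/
def ip {ι κ : Type*} [Fintype ι] [Fintype κ] (x y : Matrix ι κ ℝ) : ℝ := (xᵀ * y).trace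

section ip
variable {ι κ : Type*} [Fintype ι] [Fintype κ]

lemma ip_eq_sum (x y : Matrix ι κ ℝ) : ip x y = ∑ i, ∑ j, x i j * y i j := by
  rw [Finset.sum_comm]
  simp [ip, Matrix.trace, Matrix.mul_apply]

@[simp] lemma ip_zero_left (y : Matrix ι κ ℝ) : ip 0 y = 0 := by simp [ip]
@[simp] lemma ip_zero_right (x : Matrix ι κ ℝ) : ip x 0 = 0 := by simp [ip]
@[simp] lemma ip_neg_left (x y : Matrix ι κ ℝ) : ip (-x) y = -ip x y := by simp [ip]
@[simp] lemma ip_neg_right (x y : Matrix ι κ ℝ) : ip x (-y) = -ip x y := by simp [ip]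
@[simp] lemma ip_sub_left (x x' y : Matrix ι κ ℝ) : ip (x - x') y = ip x y - ip x' y := by
  simp [ip, Matrix.sub_mul]

lemma ip_comm (x y : Matrix ι κ ℝ) : ip x y = ip y x := by
  simp [ip_eq_sum, mul_comm]

end ip

/-- The trilinear form `∑ aᵢ cᵢⱼ bⱼ`: up to a factor it is `g₀([X₁, X₂], X₃)` for `Xᵢ ∈ 𝔪ᵢ` with
blocks `a`, `c`, `b`. -/
def tri {k : ℕ} (a : Matrix (Fin 1) (Fin 2) ℝ) (c : Matrix (Fin 2) (Fin k) ℝ)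
    (b : Matrix (Fin 1) (Fin k) ℝ) : ℝ := ip (a * c) b

section tri
variable {k : ℕ} (a : Matrix (Fin 1) (Fin 2) ℝ) (c : Matrix (Fin 2) (Fin k) ℝ)
  (b : Matrix (Fin 1) (Fin k) ℝ)

@[simp] lemma tri_neg_mid : tri a (-c) b = -tri a c b := by simp [tri]
@[simp] lemma tri_zero_left : tri 0 c b = 0 := by simp [tri]
@[simp] lemma tri_zero_right : tri a c 0 = 0 := by simp [tri]

@[simp] lemma ip_mul_eq_tri : ip (a * c) b = tri a c b := rfl

@[simp] lemma ip_transpose_mul_eq_tri : ip (aᵀ * b) c = tri a c b := by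
  rw [tri, ip_comm _ b, ip, ip, Matrix.transpose_mul, Matrix.transpose_transpose, Matrix.mul_assoc]

@[simp] lemma ip_mul_transpose_eq_tri : ip (b * cᵀ) a = tri a c b := by
  rw [tri, ip_comm _ b, ip, ip, Matrix.transpose_mul, Matrix.transpose_transpose, Matrix.mul_assoc,
    Matrix.trace_mul_comm, Matrix.mul_assoc]

@[simp] lemma tri_mul_J : tri (a * J) c b = tri a (J * c) b := by
  rw [tri, tri, Matrix.mul_assoc]

end tri

lemma J_mul_J_mul {k : ℕ} (c : Matrix (Fin 2) (Fin k) ℝ) : J * (J * c) = -c := by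
  rw [← Matrix.mul_assoc, J_mul_J]; simp

lemma mul_J_mul_J (a : Matrix (Fin 1) (Fin 2) ℝ) : a * J * J = -a := by
  rw [Matrix.mul_assoc, J_mul_J]; simp

/-- The form `g` is `α tr` on `𝔪₁`, `σ tr` on `𝔪₂`, `τ tr` on `𝔪₃`, with `𝔪₁`, `𝔪₂`, `𝔪₃`
orthogonal. -/
def IsBlockForm {n : ℕ} (g : InvariantMetric n) (α σ τ : ℝ) : Prop :=
  ∀ a c b a' c' b', g.form (ofBlocks a c b) (ofBlocks a' c' b')
    = α * ip a a' + σ * ip c c' + τ * ip b b'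

lemma mem_m1_iff {n : ℕ} (X : m n) : X ∈ m1 n ↔ ∃ a, X = ofBlocks a 0 0 := by
  refine exists_congr fun a => ?_
  rw [Subtype.ext_iff]
  simp [skewMat]

lemma mem_m2_iff {n : ℕ} (X : m n) : X ∈ m2 n ↔ ∃ c, X = ofBlocks 0 c 0 := by
  refine exists_congr fun a => ?_
  rw [Subtype.ext_iff]
  simp [skewMat]

lemma mem_m3_iff {n : ℕ} (X : m n) : X ∈ m3 n ↔ ∃ b, X = ofBlocks 0 0 b := by
  refine exists_congr fun a => ?_
  rw [Subtype.ext_iff]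
  simp [skewMat]

lemma g0_ofBlocks {n : ℕ} (a a' : Matrix (Fin 1) (Fin 2) ℝ)
    (c c' : Matrix (Fin 2) (Fin (n - 3)) ℝ) (b b' : Matrix (Fin 1) (Fin (n - 3)) ℝ) :
    g0 (ofBlocks a c b : m n) (ofBlocks a' c' b') = 2 * (ip a a' + ip c c' + ip b b') := by
  have h : ∀ x y : Mat n, (xᵀ * y).trace = ∑ i, ∑ j, x i j * y i j := fun x y => ip_eq_sum x y
  rw [g0, h]
  simp only [coe_ofBlocks, skewMat, Fintype.sum_sum_type, ip_eq_sum]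
  simp [Finset.sum_add_distrib]
  ring

lemma hasCharacteristicNumbers_iff {n : ℕ} (g : InvariantMetric n) (s t : ℝ) :
    HasCharacteristicNumbers g s t ↔ ∃ α, 0 < α ∧ IsBlockForm g α (α * s) (α * t) := by
  constructor
  · rintro ⟨r, hr, h⟩
    refine ⟨2 * r, by positivity, fun a c b a' c' b' => ?_⟩
    have := h _ ((mem_m1_iff _).2 ⟨a, rfl⟩) _ ((mem_m2_iff _).2 ⟨c, rfl⟩) _
      ((mem_m3_iff _).2 ⟨b, rfl⟩) _ ((mem_m1_iff _).2 ⟨a', rfl⟩) _ ((mem_m2_iff _).2 ⟨c', rfl⟩) _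
      ((mem_m3_iff _).2 ⟨b', rfl⟩)
    rw [← ofBlocks_eq_add, ← ofBlocks_eq_add, g0_ofBlocks, g0_ofBlocks, g0_ofBlocks] at this
    rw [this]
    simp
    ring
  · rintro ⟨α, hα, h⟩
    refine ⟨α / 2, by positivity, ?_⟩
    intro X₁ h₁ X₂ h₂ X₃ h₃ Y₁ k₁ Y₂ k₂ Y₃ k₃
    obtain ⟨a, rfl⟩ := (mem_m1_iff _).1 h₁
    obtain ⟨c, rfl⟩ := (mem_m2_iff _).1 h₂
    obtain ⟨b, rfl⟩ := (mem_m3_iff _).1 h₃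
    obtain ⟨a', rfl⟩ := (mem_m1_iff _).1 k₁
    obtain ⟨c', rfl⟩ := (mem_m2_iff _).1 k₂
    obtain ⟨b', rfl⟩ := (mem_m3_iff _).1 k₃
    rw [← ofBlocks_eq_add, ← ofBlocks_eq_add, g0_ofBlocks, g0_ofBlocks, g0_ofBlocks, h]
    simp
    ring

/-! ### Invariant metrics -/

/-- `diag(1, -1, 1) ∈ H` acts by `-1` on `𝔪₁ ⊕ 𝔪₂` and by `1` on `𝔪₃`. -/
lemma form_m12_m3 {n : ℕ} (g : InvariantMetric n) (a : Matrix (Fin 1) (Fin 2) ℝ)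
    (c : Matrix (Fin 2) (Fin (n - 3)) ℝ) (b : Matrix (Fin 1) (Fin (n - 3)) ℝ) :
    g.form (ofBlocks a c 0) (ofBlocks 0 0 b) = 0 := by
  have hR : (-1 : Matrix (Fin 2) (Fin 2) ℝ) ∈ Matrix.specialOrthogonalGroup (Fin 2) ℝ :=
    Matrix.mem_specialOrthogonalGroup_fin_two_iff.2 (by simp)
  have h := g.inv (mkH n (-1) 1 hR (one_mem _)) (ofBlocks a c 0) (ofBlocks 0 0 b)
  rw [Ad_mkH_ofBlocks, Ad_mkH_ofBlocks] at h
  simp only [Matrix.transpose_neg, Matrix.transpose_one, Matrix.mul_neg, Matrix.neg_mul,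
    Matrix.mul_one, Matrix.one_mul, Matrix.mul_zero, neg_zero] at h
  have e : (ofBlocks (-a) (-c) 0 : m n) = -ofBlocks a c 0 := by rw [ofBlocks_neg, neg_zero]
  rw [e, map_neg, LinearMap.neg_apply] at h
  linarith

/-- Invariance of the metric under `diag(1, J, 1) ∈ H`. -/
lemma form_J {n : ℕ} (g : InvariantMetric n) (a a' : Matrix (Fin 1) (Fin 2) ℝ)
    (c c' : Matrix (Fin 2) (Fin (n - 3)) ℝ) :
    g.form (ofBlocks (-(a * J)) (J * c) 0) (ofBlocks (-(a' * J)) (J * c') 0)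
      = g.form (ofBlocks a c 0) (ofBlocks a' c' 0) := by
  have h := g.inv (mkH n J 1 J_mem (one_mem _)) (ofBlocks a c 0) (ofBlocks a' c' 0)
  rw [Ad_mkH_ofBlocks, Ad_mkH_ofBlocks] at h
  simpa [J_transpose] using h

lemma form_m1_skew {n : ℕ} (g : InvariantMetric n) (a a' : Matrix (Fin 1) (Fin 2) ℝ) :
    g.form (ofBlocks (-(a * J)) 0 0) (ofBlocks a' 0 0)
      = -g.form (ofBlocks a 0 0) (ofBlocks (-(a' * J)) 0 0) := by
  have h := form_J g a (-(a' * J)) 0 0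
  simp only [Matrix.mul_zero, Matrix.neg_mul, mul_J_mul_J, neg_neg] at h
  have e : (ofBlocks a' 0 0 : m n) = -ofBlocks (-a') 0 0 := by simp [ofBlocks_neg]
  rw [← h, e, map_neg]

lemma form_m2_skew {n : ℕ} (g : InvariantMetric n) (c c' : Matrix (Fin 2) (Fin (n - 3)) ℝ) :
    g.form (ofBlocks 0 (-(J * c)) 0) (ofBlocks 0 c' 0)
      = -g.form (ofBlocks 0 c 0) (ofBlocks 0 (-(J * c')) 0) := by
  have h := form_J g 0 0 c (-(J * c'))
  simp only [Matrix.zero_mul, neg_zero, Matrix.mul_neg, J_mul_J_mul, neg_neg] at h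
  have e : (ofBlocks 0 (-(J * c)) 0 : m n) = -ofBlocks 0 (J * c) 0 := by simp [ofBlocks_neg]
  rw [← h, e, map_neg, LinearMap.neg_apply]

/-- If `𝔪₁ ⟂ 𝔪₂`, the three summands are mutually orthogonal. -/
lemma form_ofBlocks {n : ℕ} (g : InvariantMetric n)
    (h : ∀ a c, g.form (ofBlocks a 0 0) (ofBlocks 0 c 0) = 0)
    (a a' : Matrix (Fin 1) (Fin 2) ℝ)
    (c c' : Matrix (Fin 2) (Fin (n - 3)) ℝ) (b b' : Matrix (Fin 1) (Fin (n - 3)) ℝ) :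
    g.form (ofBlocks a c b) (ofBlocks a' c' b')
      = g.form (ofBlocks a 0 0) (ofBlocks a' 0 0) + g.form (ofBlocks 0 c 0) (ofBlocks 0 c' 0)
        + g.form (ofBlocks 0 0 b) (ofBlocks 0 0 b') := by
  rw [ofBlocks_eq_add a c b, ofBlocks_eq_add a' c' b']
  simp only [map_add, LinearMap.add_apply]
  rw [h a c', form_m12_m3 g a 0 b', form_m12_m3 g 0 c b', g.symm (ofBlocks 0 c 0) (ofBlocks a' 0 0),
    h a' c, g.symm (ofBlocks 0 0 b) (ofBlocks a' 0 0), form_m12_m3 g a' 0 b,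
    g.symm (ofBlocks 0 0 b) (ofBlocks 0 c' 0), form_m12_m3 g 0 c' b]
  ring

lemma isFStructure_f0 (n : ℕ) : IsFStructure (f0 n) := by
  apply Subtype.ext
  refine LinearMap.ext fun X => ?_
  obtain ⟨a, c, b, rfl⟩ := ofBlocks_surj X
  change (f0 n).1 ((f0 n).1 ((f0 n).1 (ofBlocks a c b))) + (f0 n).1 (ofBlocks a c b) = 0
  simp only [f0_ofBlocks, ofBlocks_add]
  simp [mul_J_mul_J, J_mul_J_mul]

lemma isMetricF_f0 {n : ℕ} (g : InvariantMetric n)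
    (h : ∀ a c, g.form (ofBlocks a 0 0) (ofBlocks 0 c 0) = 0) : IsMetricF g (f0 n) := by
  refine (isMetricF_iff g _).2 ⟨isFStructure_f0 n, fun X Y => ?_⟩
  obtain ⟨a, c, b, rfl⟩ := ofBlocks_surj X
  obtain ⟨a', c', b', rfl⟩ := ofBlocks_surj Y
  rw [f0_ofBlocks, f0_ofBlocks, form_ofBlocks g h (-(a * J)) a' (-(J * c)) c' 0 b',
    form_ofBlocks g h a (-(a' * J)) c (-(J * c')) b 0, form_m1_skew, form_m2_skew]
  simp only [ofBlocks_zero, map_zero, LinearMap.zero_apply]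
  ring

/-- If `f₀` is metric then `𝔪₁ ⟂ 𝔪₂`: indeed `f₀` is `Ad(diag(1, J, 1))` on `𝔪₁` and
`-Ad(diag(1, J, 1))` on `𝔪₂`. -/
lemma form_m1_m2_of_isMetricF {n : ℕ} {g : InvariantMetric n} (h : IsMetricF g (f0 n))
    (a : Matrix (Fin 1) (Fin 2) ℝ) (c : Matrix (Fin 2) (Fin (n - 3)) ℝ) :
    g.form (ofBlocks a 0 0) (ofBlocks 0 c 0) = 0 := by
  have h1 := ((isMetricF_iff g _).1 h).2 (ofBlocks a 0 0) (ofBlocks 0 (J * c) 0)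
  have h2 := form_J g a 0 0 c
  rw [f0_ofBlocks, f0_ofBlocks] at h1
  simp only [J_mul_J_mul, Matrix.mul_zero, Matrix.zero_mul, neg_zero, neg_neg] at h1 h2
  linarith

/-- The rotation by a quarter turn in the plane of the `i`-th and `j`-th coordinates. -/
lemma exists_quarter_turn {k : ℕ} {i j : Fin k} (hij : i ≠ j) :
    ∃ C ∈ Matrix.specialOrthogonalGroup (Fin k) ℝ,
      ∀ (ι : Type) [DecidableEq ι] (p : ι), Matrix.single p i (1 : ℝ) * Cᵀ = Matrix.single p j 1 ∧
        Matrix.single p j (1 : ℝ) * Cᵀ = -Matrix.single p i 1 := by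
  set P : Matrix (Fin k) (Fin k) ℝ := Equiv.Perm.permMatrix ℝ (Equiv.swap i j) with hP
  set D : Matrix (Fin k) (Fin k) ℝ := Matrix.diagonal (Function.update 1 i (-1)) with hD
  have hDD : D * D = 1 := by
    rw [hD, Matrix.diagonal_mul_diagonal, ← Matrix.diagonal_one]
    congr 1
    funext l
    by_cases hl : l = i
    · subst hl; simp
    · simp [hl]
  have hPP : P * Pᵀ = 1 := by
    rw [hP, Matrix.transpose_permMatrix, ← Matrix.permMatrix_mul]
    simp
  have hDt : Dᵀ = D := Matrix.diagonal_transpose _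
  have hPt : Pᵀ = P := by
    rw [hP, Matrix.transpose_permMatrix]
    simp
  suffices h : ∀ (ι : Type) (v : Matrix ι (Fin k) ℝ) (r : ι) (l : Fin k),
      (v * (D * P)ᵀ) r l = if l = i then -v r j else if l = j then v r i else v r l by
    refine ⟨D * P, ?_, fun ι _ p => ⟨?_, ?_⟩⟩
    · rw [Matrix.mem_specialOrthogonalGroup_iff, Matrix.mem_orthogonalGroup_iff]
      constructor
      · change (D * P) * (D * P)ᵀ = 1
        rw [Matrix.transpose_mul, hDt]
        calc D * P * (Pᵀ * D) = D * (P * Pᵀ) * D := by simp only [Matrix.mul_assoc]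
          _ = 1 := by rw [hPP, Matrix.mul_one, hDD]
      · rw [Matrix.det_mul, hP, Matrix.det_permutation, hD, Matrix.det_diagonal,
          Finset.prod_update_of_mem (Finset.mem_univ i), Equiv.Perm.sign_swap hij]
        simp
    all_goals
      ext r l
      rw [h]
      by_cases hi : l = i
      · subst hi
        simp [Matrix.single_apply, hij, hij.symm]
      · by_cases hj : l = j
        · subst hj
          simp [Matrix.single_apply, hi, hij]
        · simp [hi, hj, Ne.symm hi, Ne.symm hj]
  intro ι v r l
  rw [Matrix.transpose_mul, hDt, hPt, ← Matrix.mul_assoc, hD, Matrix.mul_diagonal, hP,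
    Equiv.Perm.permMatrix, PEquiv.mul_toMatrix_toPEquiv]
  simp only [Matrix.submatrix_apply, id_eq, Equiv.symm_swap]
  by_cases hl : l = i
  · subst hl; simp
  · by_cases hl' : l = j
    · subst hl'; simp [hij.symm]
    · simp [hl, hl', Equiv.swap_apply_of_ne_of_ne]

/-- For `n ≥ 5` a quarter turn in `SO(n - 3)` fixes `𝔪₁` and has no fixed vector on the two columns
of `𝔪₂` that it moves; so `𝔪₁ ⟂ 𝔪₂`. -/
lemma form_m1_m2_of_five_le {n : ℕ} (hn : 5 ≤ n) (g : InvariantMetric n)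
    (a : Matrix (Fin 1) (Fin 2) ℝ) (c : Matrix (Fin 2) (Fin (n - 3)) ℝ) :
    g.form (ofBlocks a 0 0) (ofBlocks 0 c 0) = 0 := by
  let L : Matrix (Fin 2) (Fin (n - 3)) ℝ →ₗ[ℝ] ℝ :=
    { toFun := fun c => g.form (ofBlocks a 0 0) (ofBlocks 0 c 0)
      map_add' := fun c c' => by rw [← map_add, ofBlocks_add]; simp
      map_smul' := fun r c => by
        rw [RingHom.id_apply, ← map_smul, ofBlocks_smul]; simp }
  have hL : L = 0 := by
    refine Matrix.ext_linearMap ℝ fun p i => LinearMap.ext_ring ?_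
    change L (Matrix.single p i 1) = 0
    have : Nontrivial (Fin (n - 3)) := Fin.nontrivial_iff_two_le.2 (by omega)
    obtain ⟨j, hj⟩ := exists_ne i
    obtain ⟨C, hC, h⟩ := exists_quarter_turn hj.symm
    have hinv : ∀ v, L (v * Cᵀ) = L v := by
      intro v
      have := g.inv (mkH n 1 C (one_mem _) hC) (ofBlocks a 0 0) (ofBlocks 0 v 0)
      rw [Ad_mkH_ofBlocks, Ad_mkH_ofBlocks] at this
      change g.form (ofBlocks a 0 0) (ofBlocks 0 (v * Cᵀ) 0)
        = g.form (ofBlocks a 0 0) (ofBlocks 0 v 0)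
      simpa using this
    obtain ⟨hi, hj'⟩ := h _ p
    have h1 := hinv (Matrix.single p i 1)
    have h2 := hinv (Matrix.single p j 1)
    rw [hi] at h1
    rw [hj', map_neg] at h2
    linarith
  exact LinearMap.congr_fun hL c

/-- An invariant inner product on `𝔪₁` is a multiple of the trace form. -/
lemma form_m1 {n : ℕ} (g : InvariantMetric n) :
    ∃ α, 0 < α ∧ ∀ a a', g.form (ofBlocks a 0 0) (ofBlocks a' 0 0) = α * ip a a' := by
  refine ⟨g.form (ofBlocks !![1, 0] 0 0) (ofBlocks !![1, 0] 0 0), g.pos _ fun h => ?_,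
    fun a a' => ?_⟩
  · rw [← ofBlocks_zero] at h
    have := congrFun (congrFun (ofBlocks_inj.1 h).1 0) 0
    simp at this
  · have e0 : (!![1, 0] : Matrix (Fin 1) (Fin 2) ℝ) * J = !![0, 1] := by
      ext i j; fin_cases i; fin_cases j <;> simp [J, Matrix.mul_apply, Fin.sum_univ_two]
    have e1 : (!![0, 1] : Matrix (Fin 1) (Fin 2) ℝ) * J = -!![1, 0] := by
      ext i j; fin_cases i; fin_cases j <;> simp [J, Matrix.mul_apply, Fin.sum_univ_two]
    have h00 := form_J g !![1, 0] !![1, 0] 0 0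
    have h01 := form_J g !![1, 0] !![0, 1] 0 0
    rw [e0] at h00
    rw [e0, e1] at h01
    have en : (ofBlocks (-!![0, 1]) 0 0 : m n) = -ofBlocks !![0, 1] 0 0 := by simp [ofBlocks_neg]
    simp only [Matrix.mul_zero, neg_neg, en, map_neg, LinearMap.neg_apply] at h00 h01
    rw [g.symm] at h01
    have ea : ∀ a : Matrix (Fin 1) (Fin 2) ℝ, (ofBlocks a 0 0 : m n)
        = a 0 0 • ofBlocks !![1, 0] 0 0 + a 0 1 • ofBlocks !![0, 1] 0 0 := by
      intro a
      rw [ofBlocks_smul, ofBlocks_smul, ofBlocks_add, ofBlocks_inj]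
      refine ⟨?_, by simp, by simp⟩
      ext i j; fin_cases i; fin_cases j <;> simp
    rw [ea a, ea a', ip_eq_sum]
    simp only [map_add, LinearMap.add_apply, map_smul, LinearMap.smul_apply, smul_eq_mul,
      Fin.sum_univ_one, Fin.sum_univ_two]
    rw [g.symm (ofBlocks !![0, 1] 0 0) (ofBlocks !![1, 0] 0 0), h00]
    have h0 : g.form (ofBlocks !![1, 0] 0 0) (ofBlocks !![0, 1] 0 0) = 0 := by linarith
    rw [h0]
    ring

/-- An invariant inner product on `𝔪₃` is a multiple of the trace form: quarter turns show that the
standard basis is orthogonal with vectors of the same length. -/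
lemma form_m3 {n : ℕ} (hn : 4 ≤ n) (g : InvariantMetric n) :
    ∃ τ, 0 < τ ∧ ∀ b b', g.form (ofBlocks 0 0 b) (ofBlocks 0 0 b') = τ * ip b b' := by
  let L : Matrix (Fin 1) (Fin (n - 3)) ℝ →ₗ[ℝ] Matrix (Fin 1) (Fin (n - 3)) ℝ →ₗ[ℝ] ℝ :=
    LinearMap.mk₂ ℝ (fun b b' => g.form (ofBlocks 0 0 b) (ofBlocks 0 0 b'))
      (fun b b' d => by rw [← LinearMap.add_apply, ← map_add, ofBlocks_add]; simp)
      (fun r b d => by rw [← LinearMap.smul_apply, ← map_smul, ofBlocks_smul]; simp)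
      (fun b d d' => by rw [← map_add, ofBlocks_add]; simp)
      (fun r b d => by rw [← map_smul, ofBlocks_smul]; simp)
  have hsymm : ∀ b d, L b d = L d b := fun b d => g.symm _ _
  let i₀ : Fin (n - 3) := ⟨0, by omega⟩
  set e : Fin (n - 3) → Matrix (Fin 1) (Fin (n - 3)) ℝ := fun i => Matrix.single 0 i 1 with he
  have hturn : ∀ i j, i ≠ j → L (e i) (e i) = L (e j) (e j) ∧ L (e i) (e j) = 0 := by
    intro i j hij
    obtain ⟨C, hC, h⟩ := exists_quarter_turn hij
    have hinv : ∀ v w, L (v * Cᵀ) (w * Cᵀ) = L v w := by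
      intro v w
      have := g.inv (mkH n 1 C (one_mem _) hC) (ofBlocks 0 0 v) (ofBlocks 0 0 w)
      rw [Ad_mkH_ofBlocks, Ad_mkH_ofBlocks] at this
      change g.form (ofBlocks 0 0 (v * Cᵀ)) (ofBlocks 0 0 (w * Cᵀ))
        = g.form (ofBlocks 0 0 v) (ofBlocks 0 0 w)
      simpa using this
    have hi : e i * Cᵀ = e j := (h _ 0).1
    have hj : e j * Cᵀ = -e i := (h _ 0).2
    have h1 := hinv (e i) (e i)
    have h2 := hinv (e i) (e j)
    rw [hi] at h1 h2
    rw [hj, map_neg, hsymm] at h2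
    exact ⟨h1.symm, by linarith⟩
  have hdiag : ∀ i, L (e i) (e i) = L (e i₀) (e i₀) := by
    intro i
    by_cases h : i = i₀
    · rw [h]
    · exact (hturn i i₀ h).1
  refine ⟨L (e i₀) (e i₀), g.pos _ fun h => ?_, fun b b' => ?_⟩
  · rw [← ofBlocks_zero] at h
    have := congrFun (congrFun (ofBlocks_inj.1 h).2.2 0) i₀
    simp [he] at this
  · have hb : ∀ b : Matrix (Fin 1) (Fin (n - 3)) ℝ, b = ∑ i, b 0 i • e i := by
      intro b
      ext r l
      fin_cases r
      simp [he, Matrix.sum_apply, Matrix.single_apply]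
    change L b b' = _
    conv_lhs => rw [hb b, hb b']
    simp only [map_sum, LinearMap.sum_apply, map_smul, LinearMap.smul_apply, smul_eq_mul]
    rw [ip_eq_sum, Fin.sum_univ_one, Finset.mul_sum]
    refine Finset.sum_congr rfl fun i _ => ?_
    rw [Finset.sum_eq_single i]
    · rw [hdiag]; ring
    · intro j _ hj
      simp [(hturn j i hj).2]
    · simp

/-! ### Conditions on the covariant derivative of `f₀` -/

/-- The form `2⟨∇_X(f₀)X, Z⟩`, expanded by the Koszul formula for a metric structure `f₀`. -/
lemma form_lam_f0 {n : ℕ} {g : InvariantMetric n} (hf : IsMetricF g (f0 n)) (X Z : m n) :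
    2 * g.form (lam g X ((f0 n).1 X) - (f0 n).1 (lam g X X)) Z
      = g.form (brm n X ((f0 n).1 X)) Z - g.form (brm n ((f0 n).1 X) Z) X
        + g.form (brm n Z X) ((f0 n).1 X) + 2 * g.form (brm n ((f0 n).1 Z) X) X := by
  have h := ((isMetricF_iff g _).1 hf).2 (lam g X X) Z
  rw [LinearMap.map_sub₂, eq_neg_of_add_eq_zero_left h, form_lam, form_lam, brm_swap ((f0 n).1 Z) X]
  have h0 : brm n X X = 0 := eq_zero_of_neg_eq_self (brm_swap X X).symm
  rw [h0]
  simp only [map_neg, map_zero, LinearMap.neg_apply, LinearMap.zero_apply]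
  ring

lemma lam_f0_eq_iff {n : ℕ} {g : InvariantMetric n} (hf : IsMetricF g (f0 n)) (X : m n) :
    lam g X ((f0 n).1 X) = (f0 n).1 (lam g X X) ↔ ∀ Z,
      g.form (brm n X ((f0 n).1 X)) Z - g.form (brm n ((f0 n).1 X) Z) X
        + g.form (brm n Z X) ((f0 n).1 X) + 2 * g.form (brm n ((f0 n).1 Z) X) X = 0 := by
  rw [← sub_eq_zero]
  refine ⟨fun h Z => ?_, fun h => g.eq_of_form_eq fun Z => ?_⟩
  · rw [← form_lam_f0 hf, h, map_zero, LinearMap.zero_apply, mul_zero]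
  · have := form_lam_f0 hf X Z
    rw [h] at this
    rw [map_zero, LinearMap.zero_apply]
    linarith

/-- For a block form, `2⟨∇_X(f₀)X, Z⟩` in terms of the trilinear form. -/
lemma form_nabla_of_isBlockForm {n : ℕ} {g : InvariantMetric n} {α σ τ : ℝ}
    (h : IsBlockForm g α σ τ) (a a' : Matrix (Fin 1) (Fin 2) ℝ)
    (c c' : Matrix (Fin 2) (Fin (n - 3)) ℝ) (b b' : Matrix (Fin 1) (Fin (n - 3)) ℝ) :
    g.form (brm n (ofBlocks a c b) ((f0 n).1 (ofBlocks a c b))) (ofBlocks a' c' b')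
        - g.form (brm n ((f0 n).1 (ofBlocks a c b)) (ofBlocks a' c' b')) (ofBlocks a c b)
        + g.form (brm n (ofBlocks a' c' b') (ofBlocks a c b)) ((f0 n).1 (ofBlocks a c b))
        + 2 * g.form (brm n ((f0 n).1 (ofBlocks a' c' b')) (ofBlocks a c b)) (ofBlocks a c b)
      = (α + 3 * σ - 3 * τ) * tri a' (J * c) b + (3 * τ - σ - 3 * α) * tri a (J * c') b
        + 2 * (α - σ) * tri a (J * c) b' := by
  simp only [f0_ofBlocks, brm_ofBlocks, h _ _ _ _ _ _, ip_sub_left, ip_neg_right, ip_neg_left,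
    Matrix.transpose_neg, Matrix.neg_mul, Matrix.mul_neg, ip_mul_eq_tri, ip_transpose_mul_eq_tri,
    ip_mul_transpose_eq_tri, Matrix.zero_mul, Matrix.mul_zero, tri_mul_J,
    ip_zero_left, ip_zero_right]
  ring

lemma isMetricF_f0_of_isBlockForm {n : ℕ} {g : InvariantMetric n} {α σ τ : ℝ}
    (h : IsBlockForm g α σ τ) : IsMetricF g (f0 n) :=
  isMetricF_f0 g fun a c => by simp [h _ _ _ _ _ _]

/-- Since `c = ∑ eᵢᵀ cᵢ` for the rows `cᵢ` of `c`, a linear form on `𝔪₂` is determined by its values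
at the brackets `aᵀ b` of `𝔪₁` with `𝔪₃`. -/
lemma eq_sum_transpose_mul {k : ℕ} (c : Matrix (Fin 2) (Fin k) ℝ) :
    c = (!![1, 0] : Matrix (Fin 1) (Fin 2) ℝ)ᵀ * (Matrix.of fun _ j => c 0 j : Matrix (Fin 1) _ ℝ)
      + (!![0, 1] : Matrix (Fin 1) (Fin 2) ℝ)ᵀ
        * (Matrix.of fun _ j => c 1 j : Matrix (Fin 1) _ ℝ) := by
  ext i j
  fin_cases i <;> simp [Matrix.mul_apply]

/-- If `f₀` is nearly Kähler, the bracket with `𝔪₃` is skew-symmetric on `𝔪₁ ⊕ 𝔪₂` for `g`. As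
`[𝔪₁, 𝔪₃] = 𝔪₂`, this determines `g` on `𝔪₂` by its values on `𝔪₁`, also in the case `n = 5` where
`𝔪₂` is reducible. -/
lemma isBlockForm_of_isNKF {n : ℕ} (hn : 4 ≤ n) {g : InvariantMetric n} (h : IsNKF g (f0 n)) :
    ∃ α τ, 0 < α ∧ 0 < τ ∧ IsBlockForm g α α τ := by
  obtain ⟨hf, hNK⟩ := (isNKF_iff g _).1 h
  have horth := fun a c => form_m1_m2_of_isMetricF hf a c
  obtain ⟨α, hα, h1⟩ := form_m1 g
  obtain ⟨τ, hτ, h3⟩ := form_m3 hn g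
  refine ⟨α, τ, hα, hτ, ?_⟩
  have key : ∀ (a : Matrix (Fin 1) (Fin 2) ℝ) (c : Matrix (Fin 2) (Fin (n - 3)) ℝ)
      (b : Matrix (Fin 1) (Fin (n - 3)) ℝ),
      g.form (ofBlocks 0 (aᵀ * b) 0) (ofBlocks 0 c 0) = α * ip (aᵀ * b) c := by
    intro a c b
    -- `f₀` maps `(a J, c, 0)` to `(a, -J c, 0)`
    have e := (lam_f0_eq_iff hf _).1 (hNK (ofBlocks (a * J) c 0)) (ofBlocks 0 0 b)
    have hJ : a * J * (J * c) = -(a * c) := by rw [Matrix.mul_assoc, J_mul_J_mul, Matrix.mul_neg]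
    have hJ' : (a * J)ᵀ * b = -(J * (aᵀ * b)) := by
      rw [Matrix.transpose_mul, J_transpose, Matrix.neg_mul, Matrix.neg_mul, Matrix.mul_assoc]
    simp only [f0_ofBlocks, brm_ofBlocks, mul_J_mul_J, J_mul_J_mul, neg_neg, Matrix.mul_neg,
      Matrix.neg_mul, Matrix.zero_mul, Matrix.mul_zero, sub_zero, zero_sub, neg_zero,
      Matrix.transpose_neg, Matrix.transpose_zero, hJ, hJ', sub_self, ofBlocks_zero, map_zero,
      LinearMap.zero_apply, mul_zero, add_zero] at e
    rw [form_ofBlocks g horth _ a, form_ofBlocks g horth _ (-(a * J)), form_m2_skew] at e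
    have en : (ofBlocks 0 (-c) 0 : m n) = -ofBlocks 0 c 0 := by simp [ofBlocks_neg]
    simp only [h1, ip_zero_left, J_mul_J_mul, neg_neg, Matrix.mul_neg, en, map_neg, ip_neg_left,
      ip_neg_right, ip_mul_transpose_eq_tri, tri_mul_J, tri_neg_mid] at e
    rw [ip_transpose_mul_eq_tri]
    linarith
  intro a c b a' c' b'
  rw [form_ofBlocks g horth, h1, h3]
  congr 2
  rw [eq_sum_transpose_mul c]
  have e : ∀ x y : Matrix (Fin 2) (Fin (n - 3)) ℝ,
      (ofBlocks 0 (x + y) 0 : m n) = ofBlocks 0 x 0 + ofBlocks 0 y 0 := by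
    intro x y; simp [ofBlocks_add]
  rw [e, map_add, LinearMap.add_apply, key, key, ← mul_add]
  simp [ip, Matrix.add_mul]

lemma isNKF_of_isBlockForm {n : ℕ} {g : InvariantMetric n} {α τ : ℝ}
    (h : IsBlockForm g α α τ) : IsNKF g (f0 n) := by
  have hf := isMetricF_f0_of_isBlockForm h
  refine (isNKF_iff g _).2 ⟨hf, fun X => (lam_f0_eq_iff hf _).2 fun Z => ?_⟩
  obtain ⟨a, c, b, rfl⟩ := ofBlocks_surj X
  obtain ⟨a', c', b', rfl⟩ := ofBlocks_surj Z
  rw [f0_ofBlocks a c b, form_nabla_of_isBlockForm h]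
  simp

lemma IsKillingF.isNKF {n : ℕ} {g : InvariantMetric n} {F : Affinor n} (h : IsKillingF g F) :
    IsNKF g F := by
  obtain ⟨hf, D, hD, h⟩ := h
  exact ⟨hf, D, hD, fun X => h _⟩

lemma isKillingF_iff_of_isBlockForm {n : ℕ} (hn : 4 ≤ n) {g : InvariantMetric n} {α τ : ℝ}
    (h : IsBlockForm g α α τ) : IsKillingF g (f0 n) ↔ 4 * α = 3 * τ := by
  have hf := isMetricF_f0_of_isBlockForm h
  rw [isKillingF_iff, and_iff_right hf]
  constructor
  · intro hK
    let i₀ : Fin (n - 3) := ⟨0, by omega⟩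
    have e := (lam_f0_eq_iff hf _).1 (hK (ofBlocks 0 (Matrix.single 1 i₀ 1) (Matrix.single 0 i₀ 1)))
      (ofBlocks (Matrix.single 0 0 1) 0 0)
    rw [form_nabla_of_isBlockForm h] at e
    have ht : tri (Matrix.single 0 0 1 : Matrix (Fin 1) (Fin 2) ℝ)
        (J * (Matrix.single 1 i₀ 1 : Matrix (Fin 2) (Fin (n - 3)) ℝ)) (Matrix.single 0 i₀ 1)
        = 1 := by
      rw [tri, ip_eq_sum]
      simp [Matrix.mul_apply, J, Matrix.single_apply, Fin.sum_univ_two, Matrix.vecMul, dotProduct]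
    rw [ht] at e
    simp at e
    linarith
  · intro hατ X
    refine (lam_f0_eq_iff hf _).2 fun Z => ?_
    obtain ⟨a, c, b, rfl⟩ := ofBlocks_surj X
    obtain ⟨a', c', b', rfl⟩ := ofBlocks_surj Z
    rw [form_nabla_of_isBlockForm h]
    linear_combination (tri a' (J * c) b - tri a (J * c') b) * hατ

/-- Every metric `f₀` is a `G₁f`-structure: `∇_{f₀X} f₀Y` has its tensorial part in `𝔪₃`, because
`[𝔪₁ ⊕ 𝔪₂, 𝔪₁ ⊕ 𝔪₂]_𝔪 ⊆ 𝔪₃ ⟂ 𝔪₁ ⊕ 𝔪₂`, and `f₀` vanishes on `𝔪₃`. -/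
lemma isG1F_of_isMetricF {n : ℕ} {g : InvariantMetric n} (hf : IsMetricF g (f0 n)) :
    IsG1F g (f0 n) := by
  refine isG1F_of g _ hf fun X Y => g.eq_of_form_eq fun Z => ?_
  obtain ⟨a, c, b, rfl⟩ := ofBlocks_surj X
  obtain ⟨a', c', b', rfl⟩ := ofBlocks_surj Y
  obtain ⟨a'', c'', b'', rfl⟩ := ofBlocks_surj Z
  rw [eq_neg_of_add_eq_zero_left (((isMetricF_iff g _).1 hf).2 _ _), map_zero,
    LinearMap.zero_apply, neg_eq_zero, form_lam]
  have h3 : ∀ (a : Matrix (Fin 1) (Fin 2) ℝ) (c : Matrix (Fin 2) (Fin (n - 3)) ℝ)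
      (b : Matrix (Fin 1) (Fin (n - 3)) ℝ), g.form (ofBlocks 0 0 b) (ofBlocks a c 0) = 0 :=
    fun a c b => (g.symm _ _).trans (form_m12_m3 g a c b)
  simp only [f0_ofBlocks, brm_ofBlocks, Matrix.transpose_neg, Matrix.neg_mul, Matrix.mul_neg,
    Matrix.zero_mul, Matrix.mul_zero, sub_zero, neg_zero, h3, add_zero, mul_zero]

/-! ### Canonical `f`-structures -/

/-- A polynomial in `θ` acts on `𝔪₁ ⊕ 𝔪₂` as a complex number `x + iy`, where `i` acts as `θ`, and
on `𝔪₃` as a real number `r`. -/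
lemma IsCanonical.exists_coeff {n : ℕ} {F : Affinor n} (h : IsCanonical F) :
    ∃ x y r : ℝ, ∀ a c b, F.1 (ofBlocks a c b)
      = ofBlocks (x • a - y • (a * J)) (x • c - y • (J * c)) (r • b) := by
  obtain ⟨p, rfl⟩ := h
  induction p using Polynomial.induction_on with
  | C s =>
    refine ⟨s, 0, s, fun a c b => ?_⟩
    rw [Polynomial.aeval_C]
    change s • ofBlocks a c b = _
    simp [ofBlocks_smul]
  | add p q hp hq =>
    obtain ⟨x, y, r, hp⟩ := hp
    obtain ⟨x', y', r', hq⟩ := hq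
    refine ⟨x + x', y + y', r + r', fun a c b => ?_⟩
    rw [map_add]
    refine (congrArg₂ (· + ·) (hp a c b) (hq a c b)).trans ?_
    rw [ofBlocks_add, ofBlocks_inj]
    refine ⟨by module, by module, by module⟩
  | monomial k s hp =>
    obtain ⟨x, y, r, hp⟩ := hp
    refine ⟨-y, x, -r, fun a c b => ?_⟩
    rw [pow_succ, ← mul_assoc, map_mul, Polynomial.aeval_X]
    refine (congrArg _ (theta_ofBlocks a c b)).trans ((hp _ _ _).trans ?_)
    rw [ofBlocks_inj]
    simp only [Matrix.neg_mul, Matrix.mul_neg, mul_J_mul_J, J_mul_J_mul]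
    refine ⟨by module, by module, by module⟩

lemma isCanonical_f0 (n : ℕ) : IsCanonical (f0 n) :=
  ⟨Polynomial.C (1 / 2) * (Polynomial.X - Polynomial.X ^ 3), by
    rw [map_mul, map_sub, map_pow, Polynomial.aeval_X, Polynomial.aeval_C, f0, Algebra.smul_def]⟩

lemma f0_ne_zero (n : ℕ) : f0 n ≠ 0 := by
  intro h
  have h1 : (f0 n).1 (ofBlocks !![1, 0] 0 0) = 0 := by rw [h]; rfl
  rw [f0_ofBlocks, ← ofBlocks_zero] at h1
  have := congrFun (congrFun (ofBlocks_inj.1 h1).1 0) 1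
  simp [J] at this

lemma affinor_ext {n : ℕ} {F F' : Affinor n}
    (h : ∀ a c b, F.1 (ofBlocks a c b) = F'.1 (ofBlocks a c b)) : F = F' := by
  apply Subtype.ext
  refine LinearMap.ext fun X => ?_
  obtain ⟨a, c, b, rfl⟩ := ofBlocks_surj X
  exact h a c b

/-- The canonical `f`-structures correspond to the solutions `(z, r)` of `z³ + z = 0`, `r³ + r = 0`
with `z` complex and `r` real. -/
lemma canonical_fStructures {n : ℕ} (hn : 4 ≤ n) {F : Affinor n} (hc : IsCanonical F)
    (hf : IsFStructure F) : F = 0 ∨ F = f0 n ∨ F = -f0 n := by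
  obtain ⟨x, y, r, h⟩ := hc.exists_coeff
  have hF : ∀ X : m n, F.1 (F.1 (F.1 X)) + F.1 X = 0 := fun X =>
    LinearMap.congr_fun (congrArg Subtype.val hf) X
  let i₀ : Fin (n - 3) := ⟨0, by omega⟩
  have e := hF (ofBlocks !![1, 0] 0 (Matrix.single 0 i₀ 1))
  simp only [h, ofBlocks_add] at e
  rw [← ofBlocks_zero, ofBlocks_inj] at e
  have e0 := congrFun (congrFun e.1 0) 0
  have e1 := congrFun (congrFun e.1 0) 1
  have e2 := congrFun (congrFun e.2.2 0) i₀
  simp [J] at e0 e1 e2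
  have hr : r = 0 := by
    have : r * (r ^ 2 + 1) = 0 := by linear_combination e2
    rcases mul_eq_zero.1 this with h | h
    · exact h
    · nlinarith
  have hx : x * (x ^ 2 - 3 * y ^ 2 + 1) = 0 := by linear_combination e0
  have hy : y * (3 * x ^ 2 - y ^ 2 + 1) = 0 := by linear_combination -e1
  have hx0 : x = 0 := by
    rcases mul_eq_zero.1 hx with hx | hx
    · exact hx
    · rcases mul_eq_zero.1 hy with hy | hy
      · rw [hy] at hx; nlinarith
      · nlinarith
  subst hr hx0
  have hy' : y = 0 ∨ y = 1 ∨ y = -1 := by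
    have : y * ((y - 1) * (y + 1)) = 0 := by linear_combination -hy
    rcases mul_eq_zero.1 this with h | h
    · exact Or.inl h
    · rcases mul_eq_zero.1 h with h | h
      · exact Or.inr (Or.inl (by linarith))
      · exact Or.inr (Or.inr (by linarith))
  rcases hy' with rfl | rfl | rfl
  · refine Or.inl (affinor_ext fun a c b => ?_)
    rw [h]
    change _ = (0 : m n)
    simp
  · refine Or.inr (Or.inl (affinor_ext fun a c b => ?_))
    rw [h, f0_ofBlocks]
    simp
  · refine Or.inr (Or.inr (affinor_ext fun a c b => ?_))
    rw [h]
    change _ = -(f0 n).1 (ofBlocks a c b)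
    rw [f0_ofBlocks, ofBlocks_neg]
    simp

lemma canonical_fStructures_eq {n : ℕ} (hn : 4 ≤ n) :
    {F : Affinor n | IsCanonical F ∧ IsFStructure F ∧ F ≠ 0} = {f0 n, -f0 n} := by
  ext F
  simp only [Set.mem_ofPred_eq, Set.mem_insert_iff, Set.mem_singleton_iff]
  constructor
  · rintro ⟨hc, hf, h0⟩
    exact (canonical_fStructures hn hc hf).resolve_left h0
  · rintro (rfl | rfl)
    · exact ⟨isCanonical_f0 n, isFStructure_f0 n, f0_ne_zero n⟩
    · obtain ⟨p, hp⟩ := isCanonical_f0 n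
      refine ⟨⟨-p, by rw [map_neg, hp]⟩, ?_, neg_ne_zero.2 (f0_ne_zero n)⟩
      have h := isFStructure_f0 n
      rw [IsFStructure] at h ⊢
      rw [Odd.neg_pow (by decide), ← neg_add, h, neg_zero]

end FlagSpace

end

theorem theorem2 (n : ℕ) (hn : 4 ≤ n) :
    {F : FlagSpace.Affinor n | FlagSpace.IsCanonical F ∧ FlagSpace.IsFStructure F ∧ F ≠ 0}
        = {FlagSpace.f0 n, -FlagSpace.f0 n} ∧
    ∀ g : FlagSpace.InvariantMetric n,
      (FlagSpace.IsKillingF g (FlagSpace.f0 n) ↔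
        FlagSpace.HasCharacteristicNumbers g 1 (4 / 3)) ∧
      (FlagSpace.IsNKF g (FlagSpace.f0 n) ↔
        ∃ t : ℝ, 0 < t ∧ FlagSpace.HasCharacteristicNumbers g 1 t) ∧
      ((5 ≤ n ∨ ∃ s t : ℝ, 0 < s ∧ 0 < t ∧ FlagSpace.HasCharacteristicNumbers g s t) →
        FlagSpace.IsG1F g (FlagSpace.f0 n)) := by
  refine ⟨FlagSpace.canonical_fStructures_eq hn, fun g => ⟨⟨fun h => ?_, fun h => ?_⟩,
    ⟨fun h => ?_, ?_⟩, ?_⟩⟩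
  · obtain ⟨α, τ, hα, hτ, hg⟩ := FlagSpace.isBlockForm_of_isNKF hn h.isNKF
    have hατ := (FlagSpace.isKillingF_iff_of_isBlockForm hn hg).1 h
    obtain rfl : τ = α * (4 / 3) := by linarith
    exact (FlagSpace.hasCharacteristicNumbers_iff g _ _).2 ⟨α, hα, by rwa [mul_one]⟩
  · obtain ⟨α, hα, hg⟩ := (FlagSpace.hasCharacteristicNumbers_iff g _ _).1 h
    rw [mul_one] at hg
    exact (FlagSpace.isKillingF_iff_of_isBlockForm hn hg).2 (by ring)
  · obtain ⟨α, τ, hα, hτ, hg⟩ := FlagSpace.isBlockForm_of_isNKF hn h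
    refine ⟨τ / α, by positivity, (FlagSpace.hasCharacteristicNumbers_iff g _ _).2 ⟨α, hα, ?_⟩⟩
    rwa [mul_one, mul_div_cancel₀ _ hα.ne']
  · rintro ⟨t, -, h⟩
    obtain ⟨α, hα, hg⟩ := (FlagSpace.hasCharacteristicNumbers_iff g _ _).1 h
    rw [mul_one] at hg
    exact FlagSpace.isNKF_of_isBlockForm hg
  · rintro (h | ⟨s, t, -, -, h⟩)
    · exact FlagSpace.isG1F_of_isMetricF
        (FlagSpace.isMetricF_f0 g (FlagSpace.form_m1_m2_of_five_le h g))
    · obtain ⟨α, -, hg⟩ := (FlagSpace.hasCharacteristicNumbers_iff g _ _).1 h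
      exact FlagSpace.isG1F_of_isMetricF (FlagSpace.isMetricF_f0_of_isBlockForm hg)
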